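/- Call a set of three distinct (possibly collinear) points of the Euclidean plane a triangle, and call two triangles congruent if some isometry of the plane (reflections allowed) maps one onto the other. For a finite set $P$ of points of the plane, the number of distinct triangles spanned by $P$ is the number of congruence classes of triangles with vertices in $P$. Let $n=N^2$ be a perfect square. Then the number $T$ of distinct triangles spanned by the $\sqrt n\times\sqrt n$ square grid $\{0,1,\dots,N-1\}\times\{0,1,\dots,N-1\}$ satisfies $$0.1558\,n^2+o(n^2)\;\le\; T\;\le\; 0.1875\,n^2+o(n^2)\qquad (n\to\infty).$$ -/

import Mathlib

/-- The Euclidean plane. -/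
abbrev Plane : Type := EuclideanSpace ℝ (Fin 2)

/-- Two sets of points of the plane are congruent if some isometry of the plane (a reflection is
allowed) maps one onto the other. -/
def planeCongruence : Setoid (Set Plane) where
  r s t := ∃ f : Plane ≃ᵢ Plane, f '' s = t
  iseqv :=
    { refl := fun s => ⟨IsometryEquiv.refl Plane, Set.image_id s⟩
      symm := by
        rintro s t ⟨f, rfl⟩
        exact ⟨f.symm, by simp [Set.image_image]⟩
      trans := by
        rintro s t u ⟨f, rfl⟩ ⟨g, rfl⟩
        exact ⟨f.trans g, Set.image_comp g f s⟩ }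

/-- The triangles with vertices in `P`: the sets of three distinct points of `P`. The three points
may be collinear. -/
def trianglesIn (P : Set Plane) : Set (Set Plane) :=
  {t | t ⊆ P ∧ t.ncard = 3}

/-- The number of distinct triangles spanned by a (finite) set `P` of points of the plane: the
number of congruence classes of triangles with vertices in `P`. -/
noncomputable def numDistinctTriangles (P : Set Plane) : ℕ :=
  ((Quotient.mk planeCongruence) '' trianglesIn P).ncard

/-- The `N × N` square grid `{0, …, N - 1} × {0, …, N - 1}`. -/
def squareGrid (N : ℕ) : Set Plane :=
  {p | ∃ a b : ℕ, a < N ∧ b < N ∧ p = !₂[(a : ℝ), (b : ℝ)]}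

/-! Upper bound. The four sides of the bounding box of a triangle are touched by only three
vertices, so some vertex is a corner of the box. Up to symmetries of the grid, the box is `[0, a] ×
[0, b]` with `a ≤ b < N`, the corner is the origin, and either the other two vertices lie on the two
opposite sides (corner triangle) or one of them is the opposite corner (diagonal triangle, where a
half turn allows `2 * x ≤ a`). This leaves about `ab + ab/2` triangles per box, and summing over the
boxes gives `3/16 * N ^ 4`.

Lower bound. Read the edge vectors `u`, `v` at the corner as Gaussian integers. A rotation to
another lattice triangle preserves `u / v` and the norms; by unique factorization it is
multiplication by a unit, unless `u` and `v` share a Gaussian prime not associated to its conjugate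
(`GaussianInt.exists_unit_of_norm_eq`). Outside this exception congruent triangles differ by a
lattice symmetry, and strict inequalities on `a, b, x, y` make the standard position unique.

In the exceptional case there are a prime `p ≡ 1 [MOD 4]` and a root `c` of `-1` modulo `p` such
that both vectors satisfy `y ≡ c x [MOD p]`, which costs a factor `p ^ 2`. With two roots per prime,
the main terms add up to at most `5/12 * ∑ 1/p ^ 2` times `N ^ 4`. Primes up to `2 * N ^ 2` occur,
too many for an additive error `O(N ^ 3)` each, so large primes are treated by a packing bound
(`card_splitPoints_le`). -/

/-! ### Arithmetic of the Gaussian integers -/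

theorem GaussianInt.norm_eq_sq_add_sq (z : GaussianInt) : z.norm = z.re ^ 2 + z.im ^ 2 := by
  rw [Zsqrtd.norm_def]; ring

theorem Prime.exists_nat_prime_dvd_of_dvd_natCast {R : Type*} [CommRing R] {π : R}
    (hπ : Prime π) (n : ℕ) (hn : n ≠ 0) (h : π ∣ (n : R)) :
    ∃ p : ℕ, p.Prime ∧ π ∣ (p : R) := by
  induction n using induction_on_primes with
  | zero => exact absurd rfl hn
  | one => exact absurd (isUnit_of_dvd_one (by simpa using h)) hπ.not_isUnit
  | prime_mul p a hp ih =>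
    rw [Nat.cast_mul] at h
    rcases hπ.dvd_or_dvd h with h | h
    · exact ⟨p, hp, h⟩
    · exact ih (by rintro rfl; simp at hn) h

/-- A Gaussian prime that is not associated to its conjugate has prime norm. -/
theorem GaussianInt.exists_prime_norm_eq {π : GaussianInt} (hπ : Prime π)
    (hs : ¬ Associated π (star π)) : ∃ p : ℕ, p.Prime ∧ π.norm = p := by
  have hdvd : π ∣ ((π.norm.natAbs : ℕ) : GaussianInt) := by
    refine ⟨star π, ?_⟩
    rw [← Zsqrtd.norm_eq_mul_conj, ← Int.cast_natCast,
      Int.natAbs_of_nonneg (GaussianInt.norm_nonneg π)]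
  have hn0 : π.norm.natAbs ≠ 0 := by
    rw [Int.natAbs_ne_zero]
    exact fun h => hπ.ne_zero ((GaussianInt.norm_eq_zero).1 h)
  obtain ⟨p, hp, w, hw⟩ := hπ.exists_nat_prime_dvd_of_dvd_natCast _ hn0 hdvd
  have hnorm : p * p = π.norm.natAbs * w.norm.natAbs := by
    have := congrArg Zsqrtd.norm hw
    rw [Zsqrtd.norm_natCast, Zsqrtd.norm_mul] at this
    rw [← Int.natAbs_mul, ← this]
    rw [Int.natAbs_mul, Int.natAbs_natCast]
  have hd : π.norm.natAbs ∣ p ^ 2 := ⟨_, by rw [pow_two, hnorm]⟩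
  obtain ⟨k, hk, hk'⟩ := (Nat.dvd_prime_pow hp).1 hd
  have hk0 : k ≠ 0 := by
    rintro rfl
    exact hπ.not_isUnit (Zsqrtd.norm_eq_one_iff.1 (by simpa using hk'))
  -- If the norm were `p ^ 2`, the cofactor `w` would be a unit, so `π` would be associated to `p`,
  -- which is its own conjugate.
  have hk2 : k ≠ 2 := by
    rintro rfl
    apply hs
    have hw1 : IsUnit w := by
      apply Zsqrtd.norm_eq_one_iff.1
      rw [hk', pow_two] at hnorm
      have : 0 < p * p := Nat.mul_pos hp.pos hp.pos
      exact Nat.eq_of_mul_eq_mul_left this (by rw [← hnorm, mul_one])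
    have h1 : Associated π (p : GaussianInt) := by
      rw [hw]; exact (associated_mul_unit_right π w hw1)
    have h2 : star π * star w = (p : GaussianInt) := by
      rw [mul_comm, ← star_mul, ← hw, star_natCast]
    have h3 : Associated (star π) (p : GaussianInt) := by
      rw [← h2]; exact associated_mul_unit_right _ _ hw1.star
    exact h1.trans h3.symm
  obtain rfl : k = 1 := by omega
  refine ⟨p, hp, ?_⟩
  rw [← Int.natAbs_of_nonneg (GaussianInt.norm_nonneg π), hk', pow_one]

/-- The multiples `x + y i` of a Gaussian prime that is not associated to its conjugate satisfy a
congruence `y ≡ c x` modulo a prime `p ≡ 1 [MOD 4]`, where `c` is a square root of `-1`. -/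
theorem GaussianInt.exists_modEq_of_dvd {π : GaussianInt} (hπ : Prime π)
    (hs : ¬ Associated π (star π)) :
    ∃ p c : ℕ, p.Prime ∧ p % 4 = 1 ∧ c < p ∧ p ∣ c ^ 2 + 1 ∧
      ∀ z, π ∣ z → (p : ℤ) ∣ z.im - c * z.re := by
  obtain ⟨p, hp, hnorm⟩ := GaussianInt.exists_prime_norm_eq hπ hs
  rw [GaussianInt.norm_eq_sq_add_sq] at hnorm
  have := Fact.mk hp
  -- Norm 2 means `±1 ± i`, and `i` or `-i` carries such a number to its conjugate.
  have hp2 : p ≠ 2 := by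
    rintro rfl
    apply hs
    obtain ⟨s, t⟩ := π
    have hnorm : s ^ 2 + t ^ 2 = 2 := hnorm
    have hs1 : s ≤ 1 := by nlinarith [sq_nonneg t]
    have hs2 : -1 ≤ s := by nlinarith [sq_nonneg t]
    have ht1 : t ≤ 1 := by nlinarith [sq_nonneg s]
    have ht2 : -1 ≤ t := by nlinarith [sq_nonneg s]
    have key : ∀ a b : GaussianInt, (∃ e f : GaussianInt, e * f = 1 ∧ a * e = b) →
        Associated a b := by
      rintro a b ⟨e, f, hef, rfl⟩
      exact associated_mul_unit_right _ _ (IsUnit.of_mul_eq_one _ hef)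
    apply key
    by_cases hst : s = t
    · subst hst
      exact ⟨⟨0, -1⟩, ⟨0, 1⟩, by ext <;> simp, by ext <;> simp⟩
    · obtain rfl : s = -t := by
        interval_cases s <;> interval_cases t <;> omega
      exact ⟨⟨0, 1⟩, ⟨0, -1⟩, by ext <;> simp, by ext <;> simp⟩
  have hmod : p % 4 = 1 := by
    have hodd := hp.eq_two_or_odd
    have h1 : (π.re ^ 2) % 4 = 0 ∨ (π.re ^ 2) % 4 = 1 := by
      rcases Int.emod_two_eq_zero_or_one π.re with h | h
      · left; obtain ⟨k, hk⟩ : ∃ k, π.re = 2 * k := ⟨π.re / 2, by omega⟩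
        rw [hk]; ring_nf; omega
      · right; obtain ⟨k, hk⟩ : ∃ k, π.re = 2 * k + 1 := ⟨π.re / 2, by omega⟩
        rw [hk]; ring_nf; omega
    have h2 : (π.im ^ 2) % 4 = 0 ∨ (π.im ^ 2) % 4 = 1 := by
      rcases Int.emod_two_eq_zero_or_one π.im with h | h
      · left; obtain ⟨k, hk⟩ : ∃ k, π.im = 2 * k := ⟨π.im / 2, by omega⟩
        rw [hk]; ring_nf; omega
      · right; obtain ⟨k, hk⟩ : ∃ k, π.im = 2 * k + 1 := ⟨π.im / 2, by omega⟩
        rw [hk]; ring_nf; omega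
    omega
  have hz : (π.re : ZMod p) ^ 2 + (π.im : ZMod p) ^ 2 = 0 := by
    have := congrArg (Int.cast : ℤ → ZMod p) hnorm
    push_cast at this
    simpa using this
  have hre : (π.re : ZMod p) ≠ 0 := by
    intro h
    have him : (π.im : ZMod p) = 0 := by
      rw [h] at hz; simpa using hz
    rw [ZMod.intCast_zmod_eq_zero_iff_dvd] at h him
    obtain ⟨a, ha⟩ := h
    obtain ⟨b, hb⟩ := him
    rw [ha, hb] at hnorm
    have hp0 : (0 : ℤ) < p := by exact_mod_cast hp.pos
    have h1 : (p : ℤ) * (a ^ 2 + b ^ 2) = 1 := by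
      apply mul_left_cancel₀ hp0.ne'
      linear_combination hnorm
    have : (p : ℤ) ∣ 1 := ⟨_, h1.symm⟩
    have := Int.le_of_dvd one_pos this
    have := hp.two_le
    omega
  -- For `π = s + ti` the root is `c = t / s`; then `s ^ 2 + t ^ 2 = 0` in `ZMod p` gives `c ^ 2 =
  -- -1`.
  set c : ZMod p := π.im * (π.re : ZMod p)⁻¹ with hc
  have hcim : c * π.re = π.im := by rw [hc]; field_simp
  have hc2 : c ^ 2 + 1 = 0 := by
    have : (c ^ 2 + 1) * (π.re : ZMod p) ^ 2 = 0 := by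
      rw [← hz, ← hcim]; ring
    exact (mul_eq_zero.1 this).resolve_right (pow_ne_zero _ hre)
  refine ⟨p, c.val, hp, hmod, ZMod.val_lt c, ?_, ?_⟩
  · rw [← ZMod.natCast_eq_zero_iff]
    push_cast
    rw [ZMod.natCast_zmod_val, hc2]
  · rintro z ⟨w, rfl⟩
    rw [← ZMod.intCast_zmod_eq_zero_iff_dvd]
    push_cast
    rw [Zsqrtd.re_mul, Zsqrtd.im_mul, ZMod.natCast_zmod_val]
    push_cast
    rw [← hcim]
    linear_combination (π.re * w.im : ZMod p) * hc2

/-- A Gaussian integer all of whose prime factors are associated to their conjugates is determined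
up to units by its norm. -/
theorem GaussianInt.associated_of_norm_eq (g : GaussianInt)
    (hg : ∀ π, Prime π → π ∣ g → Associated π (star π)) (h : GaussianInt)
    (hn : h.norm = g.norm) : Associated g h := by
  induction g using UniqueFactorizationMonoid.induction_on_prime generalizing h with
  | h₁ =>
    rw [Zsqrtd.norm_zero, GaussianInt.norm_eq_zero] at hn
    rw [hn]
  | h₂ x hx =>
    have h1 : IsUnit h := by
      rw [← Zsqrtd.norm_eq_one_iff, hn, Zsqrtd.norm_eq_one_iff]; exact hx
    exact (associated_one_iff_isUnit.2 hx).trans (associated_one_iff_isUnit.2 h1).symm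
  | h₃ a π ha hπ ih =>
    have hπs := hg π hπ (dvd_mul_right _ _)
    have hdvd : π ∣ h * star h := by
      rw [← Zsqrtd.norm_eq_mul_conj, hn, Zsqrtd.norm_eq_mul_conj, mul_assoc]
      exact dvd_mul_right _ _
    have hdh : π ∣ h := by
      -- If `π` divides `star h`, then `star π` divides `h`, and `π` is associated to `star π`.
      rcases hπ.dvd_or_dvd hdvd with h1 | ⟨w, hw⟩
      · exact h1
      · refine hπs.dvd.trans ⟨star w, ?_⟩
        rw [mul_comm, ← star_mul, ← hw, star_star]
    obtain ⟨k, rfl⟩ := hdh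
    refine Associated.mul_left _ (ih (fun ρ hρ hd => hg ρ hρ (dvd_mul_of_dvd_right hd _)) k ?_)
    rw [Zsqrtd.norm_mul, Zsqrtd.norm_mul] at hn
    exact mul_left_cancel₀ (fun h0 => hπ.ne_zero ((GaussianInt.norm_eq_zero).1 h0)) hn

/-- Write `u = g p` and `v = g q` with `g` the gcd. Coprimality of `p` and `q` turns the equality of
ratios into `u' = p h`, `v' = q h`, and the norms give `h.norm = g.norm`. The primes of `g` are the
common primes of `u` and `v`, so `h` is associated to `g`. -/
theorem GaussianInt.exists_unit_of_norm_eq {u v u' v' : GaussianInt} (hv : v ≠ 0)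
    (hgood : ∀ π, Prime π → π ∣ u → π ∣ v → Associated π (star π))
    (hnv : v'.norm = v.norm) (hr : u' * v = u * v') :
    ∃ e : GaussianIntˣ, u' = u * e ∧ v' = v * e := by
  classical
  set g := EuclideanDomain.gcd u v with hgdef
  obtain ⟨p, hp⟩ := EuclideanDomain.gcd_dvd_left u v
  obtain ⟨q, hq⟩ := EuclideanDomain.gcd_dvd_right u v
  rw [← hgdef] at hp hq
  have hg0 : g ≠ 0 := by rintro h; rw [h, zero_mul] at hq; exact hv hq
  have hq0 : q ≠ 0 := by rintro rfl; rw [mul_zero] at hq; exact hv hq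
  have hcop : IsCoprime q p := by
    have hb := EuclideanDomain.gcd_eq_gcd_ab u v
    rw [← hgdef] at hb
    refine ⟨EuclideanDomain.gcdB u v, EuclideanDomain.gcdA u v, mul_left_cancel₀ hg0 ?_⟩
    calc g * _ = (g * p) * EuclideanDomain.gcdA u v + (g * q) * EuclideanDomain.gcdB u v := by ring
      _ = u * EuclideanDomain.gcdA u v + v * EuclideanDomain.gcdB u v := by rw [← hp, ← hq]
      _ = g * 1 := by rw [← hb, mul_one]
  have hr' : u' * q = p * v' := by
    apply mul_left_cancel₀ hg0
    calc g * (u' * q) = u' * (g * q) := by ring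
      _ = (g * p) * v' := by rw [← hq, hr, ← hp]
      _ = g * (p * v') := by ring
  obtain ⟨h, rfl⟩ : q ∣ v' := hcop.dvd_of_dvd_mul_left ⟨u', by rw [← hr']; ring⟩
  have hu' : u' = p * h := by
    apply mul_right_cancel₀ hq0
    rw [hr']; ring
  have hnorm : h.norm = g.norm := by
    rw [hq, Zsqrtd.norm_mul, Zsqrtd.norm_mul, mul_comm] at hnv
    exact mul_right_cancel₀ (fun h0 => hq0 ((GaussianInt.norm_eq_zero).1 h0)) hnv
  obtain ⟨e, he⟩ := GaussianInt.associated_of_norm_eq g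
    (fun π h1 h2 => hgood π h1 (hp ▸ dvd_mul_of_dvd_left h2 _) (hq ▸ dvd_mul_of_dvd_left h2 _))
    h hnorm
  refine ⟨e, ?_, ?_⟩
  · rw [hu', ← he]; conv_rhs => rw [hp]
    ring
  · rw [← he]; conv_rhs => rw [hq]
    ring

theorem GaussianInt.unit_cases (e : GaussianIntˣ) :
    (e : GaussianInt) = ⟨1, 0⟩ ∨ (e : GaussianInt) = ⟨-1, 0⟩ ∨ (e : GaussianInt) = ⟨0, 1⟩ ∨
      (e : GaussianInt) = ⟨0, -1⟩ := by
  have h := (Zsqrtd.norm_eq_one_iff' (by norm_num) (e : GaussianInt)).2 e.isUnit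
  generalize (e : GaussianInt) = z at h ⊢
  obtain ⟨s, t⟩ := z
  replace h : s ^ 2 + t ^ 2 = 1 := by rw [← h, GaussianInt.norm_eq_sq_add_sq]
  have hs1 : s ≤ 1 := by nlinarith [sq_nonneg t]
  have hs2 : -1 ≤ s := by nlinarith [sq_nonneg t]
  have ht1 : t ≤ 1 := by nlinarith [sq_nonneg s]
  have ht2 : -1 ≤ t := by nlinarith [sq_nonneg s]
  interval_cases s <;> interval_cases t <;> simp_all

/-! ### Congruences that are lattice symmetries -/

/-- The vectors `u` and `v` lie in a common proper ideal of `ℤ[i]` generated by a prime factor of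
a rational prime `p ≡ 1 [MOD 4]`. -/
def HasSplitDivisor (u₁ u₂ v₁ v₂ : ℤ) : Prop :=
  ∃ p c : ℕ, p.Prime ∧ p % 4 = 1 ∧ c < p ∧ p ∣ c ^ 2 + 1 ∧
    (p : ℤ) ∣ u₂ - c * u₁ ∧ (p : ℤ) ∣ v₂ - c * v₁

/-- The eight linear symmetries of the lattice `ℤ²`, applied to a pair of vectors. -/
def LatticeEquivalent (u₁ u₂ v₁ v₂ u₁' u₂' v₁' v₂' : ℤ) : Prop :=
  (u₁' = u₁ ∧ u₂' = u₂ ∧ v₁' = v₁ ∧ v₂' = v₂) ∨ (u₁' = -u₁ ∧ u₂' = -u₂ ∧ v₁' = -v₁ ∧ v₂' = -v₂) ∨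
  (u₁' = -u₁ ∧ u₂' = u₂ ∧ v₁' = -v₁ ∧ v₂' = v₂) ∨ (u₁' = u₁ ∧ u₂' = -u₂ ∧ v₁' = v₁ ∧ v₂' = -v₂) ∨
  (u₁' = u₂ ∧ u₂' = u₁ ∧ v₁' = v₂ ∧ v₂' = v₁) ∨ (u₁' = -u₂ ∧ u₂' = -u₁ ∧ v₁' = -v₂ ∧ v₂' = -v₁) ∨
  (u₁' = -u₂ ∧ u₂' = u₁ ∧ v₁' = -v₂ ∧ v₂' = v₁) ∨ (u₁' = u₂ ∧ u₂' = -u₁ ∧ v₁' = v₂ ∧ v₂' = -v₁)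

/-- The dot product and determinant are, up to sign, the real and imaginary parts of `u * star v`,
so `u' * star v' = u * star v`. Multiplying by `v * v'` and cancelling the common norm of `v` and
`v'` gives `u' * v = u * v'`. -/
theorem latticeEquivalent_of_rotation {u₁ u₂ v₁ v₂ u₁' u₂' v₁' v₂' : ℤ}
    (hv : v₁ ≠ 0 ∨ v₂ ≠ 0) (hgood : ¬ HasSplitDivisor u₁ u₂ v₁ v₂)
    (hnv : v₁' ^ 2 + v₂' ^ 2 = v₁ ^ 2 + v₂ ^ 2)
    (hdot : u₁' * v₁' + u₂' * v₂' = u₁ * v₁ + u₂ * v₂)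
    (hdet : u₁' * v₂' - u₂' * v₁' = u₁ * v₂ - u₂ * v₁) :
    ∃ e : GaussianIntˣ, (⟨u₁', u₂'⟩ : GaussianInt) = ⟨u₁, u₂⟩ * e ∧
      (⟨v₁', v₂'⟩ : GaussianInt) = ⟨v₁, v₂⟩ * e := by
  have hv0 : v₁ ^ 2 + v₂ ^ 2 ≠ 0 := by
    rcases hv with h | h <;> positivity
  apply GaussianInt.exists_unit_of_norm_eq
  · intro h
    rw [Zsqrtd.ext_iff] at h
    simp only [Zsqrtd.re_zero, Zsqrtd.im_zero] at h
    omega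
  · intro π hπ hu hv
    by_contra hs
    obtain ⟨p, c, hp, hp4, hc, hpc, hd⟩ := GaussianInt.exists_modEq_of_dvd hπ hs
    exact hgood ⟨p, c, hp, hp4, hc, hpc, hd _ hu, hd _ hv⟩
  · simpa only [GaussianInt.norm_eq_sq_add_sq] using hnv
  · ext
    · simp only [Zsqrtd.re_mul]
      apply mul_left_cancel₀ hv0
      linear_combination (-(u₁' * v₁ - u₂' * v₂)) * hnv + (v₁ * v₁' - v₂ * v₂') * hdot +
        (v₁ * v₂' + v₂ * v₁') * hdet
    · simp only [Zsqrtd.im_mul]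
      apply mul_left_cancel₀ hv0
      linear_combination (-(u₁' * v₂ + u₂' * v₁)) * hnv + (v₁ * v₂' + v₂ * v₁') * hdot +
        (v₂ * v₂' - v₁ * v₁') * hdet

/-- Two congruent lattice triangles differ by a symmetry of the lattice if the edge vectors of the
first have no common split divisor. -/
theorem latticeEquivalent_of_congruent {u₁ u₂ v₁ v₂ u₁' u₂' v₁' v₂' : ℤ}
    (hv : v₁ ≠ 0 ∨ v₂ ≠ 0) (hgood : ¬ HasSplitDivisor u₁ u₂ v₁ v₂)
    (hnu : u₁' ^ 2 + u₂' ^ 2 = u₁ ^ 2 + u₂ ^ 2)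
    (hnv : v₁' ^ 2 + v₂' ^ 2 = v₁ ^ 2 + v₂ ^ 2)
    (hdot : u₁' * v₁' + u₂' * v₂' = u₁ * v₁ + u₂ * v₂) :
    LatticeEquivalent u₁ u₂ v₁ v₂ u₁' u₂' v₁' v₂' := by
  -- The squared determinant is the Gram determinant `|u|² |v|² - (u · v)²`. Its root is known up to
  -- sign; the negative sign is reduced to a rotation by reflecting the primed triangle.
  have hsq : (u₁' * v₂' - u₂' * v₁') ^ 2 = (u₁ * v₂ - u₂ * v₁) ^ 2 := by
    linear_combination (v₁' ^ 2 + v₂' ^ 2) * hnu + (u₁ ^ 2 + u₂ ^ 2) * hnv -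
      (u₁' * v₁' + u₂' * v₂' + u₁ * v₁ + u₂ * v₂) * hdot
  unfold LatticeEquivalent
  rcases sq_eq_sq_iff_eq_or_eq_neg.1 hsq with hdet | hdet
  · obtain ⟨e, h1, h2⟩ := latticeEquivalent_of_rotation hv hgood hnv hdot hdet
    rcases GaussianInt.unit_cases e with he | he | he | he <;> rw [he] at h1 h2 <;>
      simp only [Zsqrtd.ext_iff, Zsqrtd.re_mul, Zsqrtd.im_mul, mul_zero, mul_one, mul_neg, add_zero,
        zero_add, neg_mul, neg_neg, one_mul] at h1 h2
    · exact .inl <| by omega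
    · exact .inr <| .inl <| by omega
    · exact .inr <| .inr <| .inr <| .inr <| .inr <| .inr <| .inl <| by omega
    · exact .inr <| .inr <| .inr <| .inr <| .inr <| .inr <| .inr <| by omega
  · obtain ⟨e, h1, h2⟩ := latticeEquivalent_of_rotation (u₁' := u₁') (u₂' := -u₂') (v₁' := v₁')
      (v₂' := -v₂') hv hgood (by linear_combination hnv) (by linear_combination hdot)
      (by linear_combination -hdet)
    rcases GaussianInt.unit_cases e with he | he | he | he <;> rw [he] at h1 h2 <;>
      simp only [Zsqrtd.ext_iff, Zsqrtd.re_mul, Zsqrtd.im_mul, mul_zero, mul_one, mul_neg, add_zero,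
        zero_add, neg_mul, neg_neg, one_mul] at h1 h2
    · exact .inr <| .inr <| .inr <| .inl <| by omega
    · exact .inr <| .inr <| .inl <| by omega
    · exact .inr <| .inr <| .inr <| .inr <| .inr <| .inl <| by omega
    · exact .inr <| .inr <| .inr <| .inr <| .inl <| by omega

/-! ### Lattice triangles in the plane and uniqueness of their standard position -/

/-- The point of the plane with the given integer coordinates. -/
noncomputable def latticePoint (p : ℤ × ℤ) : Plane := !₂[(p.1 : ℝ), (p.2 : ℝ)]

/-- The triangle with the given lattice points as vertices. -/
noncomputable def latticeTriangle (p q r : ℤ × ℤ) : Set Plane :=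
  {latticePoint p, latticePoint q, latticePoint r}

/-- The squared distance of two lattice points. -/
def sqDist (p q : ℤ × ℤ) : ℤ := (p.1 - q.1) ^ 2 + (p.2 - q.2) ^ 2

theorem dist_latticePoint (p q : ℤ × ℤ) :
    dist (latticePoint p) (latticePoint q) = √(sqDist p q : ℝ) := by
  rw [EuclideanSpace.dist_eq, Fin.sum_univ_two]
  simp [latticePoint, sqDist, Real.dist_eq, sq_abs]

theorem sqDist_nonneg (p q : ℤ × ℤ) : 0 ≤ sqDist p q := by
  unfold sqDist; positivity

theorem sqDist_eq_of_dist_eq {p q p' q' : ℤ × ℤ}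
    (h : dist (latticePoint p') (latticePoint q') = dist (latticePoint p) (latticePoint q)) :
    sqDist p' q' = sqDist p q := by
  rw [dist_latticePoint, dist_latticePoint, Real.sqrt_inj (by exact_mod_cast sqDist_nonneg _ _)
    (by exact_mod_cast sqDist_nonneg _ _)] at h
  exact_mod_cast h

theorem latticePoint_injective : Function.Injective latticePoint := by
  intro p q h
  have h0 := congrFun (congrArg WithLp.ofLp h) 0
  have h1 := congrFun (congrArg WithLp.ofLp h) 1
  simp only [latticePoint, Matrix.cons_val_zero, Matrix.cons_val_one, Int.cast_inj] at h0 h1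
  exact Prod.ext h0 h1

theorem exists_sqDist_eq_of_congruent {p q r p' q' r' : ℤ × ℤ}
    (h : planeCongruence (latticeTriangle p q r) (latticeTriangle p' q' r')) :
    ∃ a b c : ℤ × ℤ, (a = p' ∨ a = q' ∨ a = r') ∧ (b = p' ∨ b = q' ∨ b = r') ∧
      (c = p' ∨ c = q' ∨ c = r') ∧ sqDist b a = sqDist q p ∧ sqDist c a = sqDist r p ∧
      sqDist c b = sqDist r q := by
  obtain ⟨f, hf⟩ := h
  have key : ∀ x : ℤ × ℤ, latticePoint x ∈ latticeTriangle p q r →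
      ∃ y, (y = p' ∨ y = q' ∨ y = r') ∧ f (latticePoint x) = latticePoint y := by
    intro x hx
    have hy : f (latticePoint x) ∈ latticeTriangle p' q' r' := hf ▸ Set.mem_image_of_mem f hx
    rcases hy with hy | hy | hy
    · exact ⟨p', by simp, hy⟩
    · exact ⟨q', by simp, hy⟩
    · exact ⟨r', by simp, hy⟩
  obtain ⟨a, ha, hfa⟩ := key p (by simp [latticeTriangle])
  obtain ⟨b, hb, hfb⟩ := key q (by simp [latticeTriangle])
  obtain ⟨c, hc, hfc⟩ := key r (by simp [latticeTriangle])
  refine ⟨a, b, c, ha, hb, hc, ?_, ?_, ?_⟩ <;> apply sqDist_eq_of_dist_eq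
  · rw [← hfa, ← hfb, f.dist_eq]
  · rw [← hfa, ← hfc, f.dist_eq]
  · rw [← hfb, ← hfc, f.dist_eq]

/-- The triangle with bounding box `[0, a] × [0, b]` that has one vertex in a corner of the box and
the other two on the opposite sides. -/
noncomputable def cornerTriangle (a b x y : ℤ) : Set Plane := latticeTriangle (0, 0) (a, y) (x, b)

/-- The triangle with bounding box `[0, a] × [0, b]` that has two vertices in opposite corners of
the box. -/
noncomputable def diagonalTriangle (a b x y : ℤ) : Set Plane := latticeTriangle (0, 0) (a, b) (x, y)

/-- The three squared side lengths determine the dot product by `2 u · v = |u|² + |v|² - |u - v|²`.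
-/
theorem latticeEquivalent_of_planeCongruence {u₁ u₂ v₁ v₂ : ℤ} {p q r : ℤ × ℤ}
    (hv : v₁ ≠ 0 ∨ v₂ ≠ 0) (hgood : ¬ HasSplitDivisor u₁ u₂ v₁ v₂)
    (h : planeCongruence (latticeTriangle (0, 0) (u₁, u₂) (v₁, v₂)) (latticeTriangle p q r)) :
    ∃ a b c : ℤ × ℤ, (a = p ∨ a = q ∨ a = r) ∧ (b = p ∨ b = q ∨ b = r) ∧
      (c = p ∨ c = q ∨ c = r) ∧
      LatticeEquivalent u₁ u₂ v₁ v₂ (b.1 - a.1) (b.2 - a.2) (c.1 - a.1) (c.2 - a.2) := by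
  obtain ⟨a, b, c, ha, hb, hc, h1, h2, h3⟩ := exists_sqDist_eq_of_congruent h
  refine ⟨a, b, c, ha, hb, hc, latticeEquivalent_of_congruent hv hgood ?_ ?_ ?_⟩ <;>
    simp only [sqDist, sub_zero] at h1 h2 h3
  · linarith
  · linarith
  · linarith

/-- Congruent corner triangles in general position whose edge vectors have no common split divisor
are equal. -/
theorem cornerTriangle_inj {a b x y a' b' x' y' : ℤ} (hx : 0 < x) (hxa : x < a) (hy : 0 < y)
    (hyb : y < b) (hab : a < b) (hx' : 0 < x') (hxa' : x' < a') (hy' : 0 < y') (hyb' : y' < b')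
    (hab' : a' < b') (hgood : ¬ HasSplitDivisor a y x b)
    (h : planeCongruence (cornerTriangle a b x y) (cornerTriangle a' b' x' y')) :
    a = a' ∧ b = b' ∧ x = x' ∧ y = y' := by
  obtain ⟨p, q, r, hp, hq, hr, hL⟩ := latticeEquivalent_of_planeCongruence (by omega) hgood h
  unfold LatticeEquivalent at hL
  -- The vertex assignment need not be known to be bijective: coincident choices would give a zero
  -- edge vector or two equal ones, against the strict inequalities.
  rcases hp with rfl | rfl | rfl <;> rcases hq with rfl | rfl | rfl <;>
    rcases hr with rfl | rfl | rfl <;> simp only [sub_self, zero_sub, sub_zero] at hL <;> omega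

/-- The condition `2 * x < a` excludes the half turn that exchanges the two corners, and `a < b`
excludes the swap of coordinates. -/
theorem diagonalTriangle_inj {a b x y a' b' x' y' : ℤ} (hx : 0 < x) (hxa : 2 * x < a) (hy : 0 < y)
    (hyb : y < b) (hab : a < b) (hx' : 0 < x') (hxa' : 2 * x' < a') (hy' : 0 < y') (hyb' : y' < b')
    (hab' : a' < b') (hgood : ¬ HasSplitDivisor a b x y)
    (h : planeCongruence (diagonalTriangle a b x y) (diagonalTriangle a' b' x' y')) :
    a = a' ∧ b = b' ∧ x = x' ∧ y = y' := by
  obtain ⟨p, q, r, hp, hq, hr, hL⟩ := latticeEquivalent_of_planeCongruence (by omega) hgood h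
  unfold LatticeEquivalent at hL
  rcases hp with rfl | rfl | rfl <;> rcases hq with rfl | rfl | rfl <;>
    rcases hr with rfl | rfl | rfl <;> simp only [sub_self, zero_sub, sub_zero] at hL <;> omega

/-- In general position a diagonal triangle has two vertices at corners of its bounding box and a
corner triangle only one; lattice symmetries preserve this number. -/
theorem not_planeCongruence_corner_diagonal {a b x y a' b' x' y' : ℤ} (hx : 0 < x) (hxa : x < a)
    (hy : 0 < y) (hyb : y < b) (hab : a < b) (hx' : 0 < x') (hxa' : x' < a') (hy' : 0 < y')
    (hyb' : y' < b') (hab' : a' < b') (hgood : ¬ HasSplitDivisor a y x b) :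
    ¬ planeCongruence (cornerTriangle a b x y) (diagonalTriangle a' b' x' y') := by
  intro h
  obtain ⟨p, q, r, hp, hq, hr, hL⟩ := latticeEquivalent_of_planeCongruence (by omega) hgood h
  unfold LatticeEquivalent at hL
  rcases hp with rfl | rfl | rfl <;> rcases hq with rfl | rfl | rfl <;>
    rcases hr with rfl | rfl | rfl <;> simp only [sub_self, zero_sub, sub_zero] at hL <;> omega

/-! ### Existence of a standard position -/

/-- The isometry `(x, y) ↦ (s x + t, s' y + t')` of the plane, where `s` and `s'` are signs. -/
noncomputable def signIsometry (s s' : ℤˣ) (t t' : ℝ) : Plane ≃ᵢ Plane :=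
  IsometryEquiv.mk' (fun p => !₂[(s : ℤ) * p 0 + t, (s' : ℤ) * p 1 + t'])
    (fun p => !₂[(s : ℤ) * (p 0 - t), (s' : ℤ) * (p 1 - t')])
    (by
      intro p
      ext i
      rcases Int.units_eq_one_or s with rfl | rfl <;> rcases Int.units_eq_one_or s' with rfl | rfl <;>
        fin_cases i <;> simp)
    (by
      refine Isometry.of_dist_eq fun p q => ?_
      rw [EuclideanSpace.dist_eq, EuclideanSpace.dist_eq, Fin.sum_univ_two, Fin.sum_univ_two]
      simp only [Real.dist_eq, sq_abs]
      congr 1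
      rcases Int.units_eq_one_or s with rfl | rfl <;> rcases Int.units_eq_one_or s' with rfl | rfl <;>
        simp <;> ring)

theorem signIsometry_apply (s s' : ℤˣ) (t t' : ℝ) (p : Plane) :
    signIsometry s s' t t' p = !₂[(s : ℤ) * p 0 + t, (s' : ℤ) * p 1 + t'] := rfl

/-- The reflection of the plane that swaps the coordinates. -/
noncomputable def swapIsometry : Plane ≃ᵢ Plane :=
  IsometryEquiv.mk' (fun p => !₂[p 1, p 0]) (fun p => !₂[p 1, p 0])
    (by
      intro p
      ext i
      fin_cases i <;> simp)
    (by
      refine Isometry.of_dist_eq fun p q => ?_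
      rw [EuclideanSpace.dist_eq, EuclideanSpace.dist_eq, Fin.sum_univ_two, Fin.sum_univ_two]
      simp [add_comm])

theorem swapIsometry_apply (p : Plane) : swapIsometry p = !₂[p 1, p 0] := rfl

theorem planeCongruence_latticeTriangle_of_map (f : Plane ≃ᵢ Plane) {p q r p' q' r' : ℤ × ℤ}
    (hp : f (latticePoint p) = latticePoint p') (hq : f (latticePoint q) = latticePoint q')
    (hr : f (latticePoint r) = latticePoint r') :
    planeCongruence (latticeTriangle p q r) (latticeTriangle p' q' r') := by
  refine ⟨f, ?_⟩
  simp only [latticeTriangle, Set.image_insert_eq, Set.image_singleton, hp, hq, hr]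

theorem planeCongruence_latticeTriangle_sign (s s' : ℤˣ) (t t' : ℤ) (p q r : ℤ × ℤ) :
    planeCongruence (latticeTriangle p q r)
      (latticeTriangle (s * p.1 + t, s' * p.2 + t') (s * q.1 + t, s' * q.2 + t')
        (s * r.1 + t, s' * r.2 + t')) := by
  apply planeCongruence_latticeTriangle_of_map (signIsometry s s' t t') <;>
    simp [signIsometry_apply, latticePoint]

theorem planeCongruence_latticeTriangle_swap (p q r : ℤ × ℤ) :
    planeCongruence (latticeTriangle p q r) (latticeTriangle p.swap q.swap r.swap) := by
  apply planeCongruence_latticeTriangle_of_map swapIsometry <;>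
    simp [swapIsometry_apply, latticePoint]

theorem latticeTriangle_comm₁₂ (p q r : ℤ × ℤ) :
    latticeTriangle p q r = latticeTriangle q p r := by
  simp only [latticeTriangle, Set.insert_comm]

theorem latticeTriangle_comm₂₃ (p q r : ℤ × ℤ) :
    latticeTriangle p q r = latticeTriangle p r q := by
  simp only [latticeTriangle, Set.pair_comm]

/-- The triangle `t` is congruent to one in standard position in a box `[0, a] × [0, b]` with
`a ≤ b < N`. -/
def HasStandardPosition (N : ℤ) (t : Set Plane) : Prop :=
  ∃ a b x y : ℤ, 0 ≤ x ∧ x ≤ a ∧ 0 ≤ y ∧ y ≤ b ∧ a ≤ b ∧ b < N ∧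
    (planeCongruence t (cornerTriangle a b x y) ∨
      2 * x ≤ a ∧ planeCongruence t (diagonalTriangle a b x y))

theorem HasStandardPosition.congr {N : ℤ} {s t : Set Plane} (h : HasStandardPosition N t)
    (hst : planeCongruence s t) : HasStandardPosition N s := by
  obtain ⟨a, b, x, y, h1, h2, h3, h4, h5, h6, h7⟩ := h
  exact ⟨a, b, x, y, h1, h2, h3, h4, h5, h6,
    h7.imp (planeCongruence.trans hst) (fun h => ⟨h.1, planeCongruence.trans hst h.2⟩)⟩

theorem hasStandardPosition_corner {N a b x y : ℤ} (hx : 0 ≤ x) (hxa : x ≤ a) (hy : 0 ≤ y)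
    (hyb : y ≤ b) (ha : a < N) (hb : b < N) : HasStandardPosition N (cornerTriangle a b x y) := by
  rcases le_total a b with hab | hab
  · exact ⟨a, b, x, y, hx, hxa, hy, hyb, hab, hb, .inl (planeCongruence.refl _)⟩
  · refine ⟨b, a, y, x, hy, hyb, hx, hxa, hab, ha, .inl ?_⟩
    refine planeCongruence.trans (planeCongruence_latticeTriangle_swap _ _ _) ?_
    rw [latticeTriangle_comm₂₃]
    exact planeCongruence.refl _

theorem hasStandardPosition_diagonal {N a b x y : ℤ} (hx : 0 ≤ x) (hxa : x ≤ a) (hy : 0 ≤ y)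
    (hyb : y ≤ b) (ha : a < N) (hb : b < N) :
    HasStandardPosition N (diagonalTriangle a b x y) := by
  wlog hab : a ≤ b generalizing a b x y
  · exact (this hy hyb hx hxa hb ha (le_of_not_ge hab)).congr
      (planeCongruence_latticeTriangle_swap _ _ _)
  by_cases h2 : 2 * x ≤ a
  · exact ⟨a, b, x, y, hx, hxa, hy, hyb, hab, hb, .inr ⟨h2, planeCongruence.refl _⟩⟩
  · refine ⟨a, b, a - x, b - y, by omega, by omega, by omega, by omega, hab, hb,
      .inr ⟨by omega, ?_⟩⟩
    refine planeCongruence.trans (planeCongruence_latticeTriangle_sign (-1) (-1) a b _ _ _) ?_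
    rw [latticeTriangle_comm₁₂]
    convert planeCongruence.refl _ using 2
    simp only [diagonalTriangle]
    congr 2 <;> simp <;> ring

/-- After sorting by the first coordinate and possibly reflecting vertically, `p` is on the left
side of the box, `r` on the right side and not below `p`. The height of `q` relative to them decides
which vertex is a corner. -/
theorem hasStandardPosition_latticeTriangle {N : ℤ} (p q r : ℤ × ℤ) (hp : 0 ≤ p.1 ∧ p.1 < N)
    (hp' : 0 ≤ p.2 ∧ p.2 < N) (hq : 0 ≤ q.1 ∧ q.1 < N) (hq' : 0 ≤ q.2 ∧ q.2 < N)
    (hr : 0 ≤ r.1 ∧ r.1 < N) (hr' : 0 ≤ r.2 ∧ r.2 < N) :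
    HasStandardPosition N (latticeTriangle p q r) := by
  wlog hpq : p.1 ≤ q.1 generalizing p q r
  · rw [latticeTriangle_comm₁₂]
    exact this q p r hq hq' hp hp' hr hr' (le_of_not_ge hpq)
  wlog hqr : q.1 ≤ r.1 generalizing p q r
  · rcases le_total p.1 r.1 with h | h
    · rw [latticeTriangle_comm₂₃]
      exact this p r q hp hp' hr hr' hq hq' h (le_of_not_ge hqr)
    · rw [latticeTriangle_comm₂₃, latticeTriangle_comm₁₂]
      exact this r p q hr hr' hp hp' hq hq' h hpq
  wlog hpr : p.2 ≤ r.2 generalizing p q r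
  · refine (this (1 * p.1 + 0, -1 * p.2 + (N - 1)) (1 * q.1 + 0, -1 * q.2 + (N - 1))
      (1 * r.1 + 0, -1 * r.2 + (N - 1)) ?_ ?_ ?_ ?_ ?_ ?_ ?_ ?_ ?_).congr
      (planeCongruence_latticeTriangle_sign 1 (-1) 0 (N - 1) p q r) <;> simp only <;> omega
  have base := planeCongruence_latticeTriangle_sign 1 1 (-p.1) (-p.2) p q r
  rcases lt_or_ge r.2 q.2 with h | h
  · refine (hasStandardPosition_corner (a := r.1 - p.1) (b := q.2 - p.2) (x := q.1 - p.1)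
      (y := r.2 - p.2) ?_ ?_ ?_ ?_ ?_ ?_).congr (planeCongruence.trans base ?_) <;> try omega
    rw [latticeTriangle_comm₂₃]
    convert planeCongruence.refl _ using 2
    simp only [cornerTriangle]
    congr 2 <;> simp <;> ring
  · rcases lt_or_ge q.2 p.2 with h' | h'
    -- Here `r` is the upper right corner of the box; a half turn brings it to the origin.
    · refine (hasStandardPosition_corner (a := r.1 - p.1) (b := r.2 - q.2) (x := r.1 - q.1)
        (y := r.2 - p.2) ?_ ?_ ?_ ?_ ?_ ?_).congr (planeCongruence.trans
          (planeCongruence_latticeTriangle_sign (-1) (-1) r.1 r.2 p q r) ?_) <;> try omega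
      rw [latticeTriangle_comm₂₃, latticeTriangle_comm₁₂]
      convert planeCongruence.refl _ using 2
      simp only [cornerTriangle]
      congr 2 <;> simp <;> ring
    · refine (hasStandardPosition_diagonal (a := r.1 - p.1) (b := r.2 - p.2) (x := q.1 - p.1)
        (y := q.2 - p.2) ?_ ?_ ?_ ?_ ?_ ?_).congr (planeCongruence.trans base ?_) <;> try omega
      rw [latticeTriangle_comm₂₃]
      convert planeCongruence.refl _ using 2
      simp only [diagonalTriangle]
      congr 2 <;> simp <;> ring

theorem mem_squareGrid_iff {N : ℕ} {x : Plane} :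
    x ∈ squareGrid N ↔ ∃ p : ℤ × ℤ, (0 ≤ p.1 ∧ p.1 < N) ∧ (0 ≤ p.2 ∧ p.2 < N) ∧
      x = latticePoint p := by
  constructor
  · rintro ⟨a, b, ha, hb, rfl⟩
    exact ⟨(a, b), by simpa using ha, by simpa using hb, by simp [latticePoint]⟩
  · rintro ⟨⟨a, b⟩, ⟨ha, ha'⟩, ⟨hb, hb'⟩, rfl⟩
    lift a to ℕ using ha
    lift b to ℕ using hb
    exact ⟨a, b, by simpa using ha', by simpa using hb', by simp [latticePoint]⟩

theorem squareGrid_finite (N : ℕ) : (squareGrid N).Finite := by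
  refine ((Set.finite_Ico (0 : ℤ × ℤ) (N, N)).image latticePoint).subset ?_
  intro x hx
  obtain ⟨p, h1, h2, rfl⟩ := mem_squareGrid_iff.1 hx
  refine ⟨p, ⟨⟨h1.1, h2.1⟩, lt_of_le_of_ne ⟨h1.2.le, h2.2.le⟩ ?_⟩, rfl⟩
  rintro rfl
  exact lt_irrefl _ h1.2

theorem hasStandardPosition_of_mem_trianglesIn {N : ℕ} {t : Set Plane}
    (ht : t ∈ trianglesIn (squareGrid N)) : HasStandardPosition N t := by
  obtain ⟨hsub, hcard⟩ := ht
  obtain ⟨x, y, z, -, -, -, rfl⟩ := Set.ncard_eq_three.1 hcard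
  obtain ⟨p, hp, hp', rfl⟩ := mem_squareGrid_iff.1 (hsub (by simp : x ∈ _))
  obtain ⟨q, hq, hq', rfl⟩ := mem_squareGrid_iff.1 (hsub (by simp : y ∈ _))
  obtain ⟨r, hr, hr', rfl⟩ := mem_squareGrid_iff.1 (hsub (by simp : z ∈ _))
  exact hasStandardPosition_latticeTriangle p q r hp hp' hq hq' hr hr'

/-! ### The upper bound -/

/-- The quadruples `⟨b, a, x, y⟩` with `b < N`, `a ∈ A b`, `x ∈ X a` and `y ∈ Y b`. -/
def boxIndex (N : ℕ) (A X Y : ℕ → Finset ℕ) : Finset (Σ _ : ℕ, Σ _ : ℕ, ℕ × ℕ) :=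
  (Finset.range N).sigma fun b => (A b).sigma fun a => X a ×ˢ Y b

theorem card_boxIndex (N : ℕ) (A X Y : ℕ → Finset ℕ) :
    (boxIndex N A X Y).card = ∑ b ∈ Finset.range N, ∑ a ∈ A b, (X a).card * (Y b).card := by
  simp only [boxIndex, Finset.card_sigma, Finset.card_product]

theorem mem_boxIndex {N : ℕ} {A X Y : ℕ → Finset ℕ} {i : Σ _ : ℕ, Σ _ : ℕ, ℕ × ℕ} :
    i ∈ boxIndex N A X Y ↔ i.1 < N ∧ i.2.1 ∈ A i.1 ∧ i.2.2.1 ∈ X i.2.1 ∧ i.2.2.2 ∈ Y i.1 := by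
  simp only [boxIndex, Finset.mem_sigma, Finset.mem_product, Finset.mem_range]

/-- The congruence class of the corner triangle with the given index. -/
noncomputable def cornerClass (i : Σ _ : ℕ, Σ _ : ℕ, ℕ × ℕ) : Quotient planeCongruence :=
  Quotient.mk _ (cornerTriangle i.2.1 i.1 i.2.2.1 i.2.2.2)

/-- The congruence class of the diagonal triangle with the given index. -/
noncomputable def diagonalClass (i : Σ _ : ℕ, Σ _ : ℕ, ℕ × ℕ) : Quotient planeCongruence :=
  Quotient.mk _ (diagonalTriangle i.2.1 i.1 i.2.2.1 i.2.2.2)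

theorem numDistinctTriangles_le (N : ℕ) :
    numDistinctTriangles (squareGrid N) ≤
      ∑ b ∈ Finset.range N, ∑ a ∈ Finset.range (b + 1), (a + 1) * (b + 1) +
      ∑ b ∈ Finset.range N, ∑ a ∈ Finset.range (b + 1), (a / 2 + 1) * (b + 1) := by
  classical
  set I := boxIndex N (fun b => Finset.range (b + 1)) (fun a => Finset.range (a + 1))
    (fun b => Finset.range (b + 1)) with hI
  set J := boxIndex N (fun b => Finset.range (b + 1)) (fun a => Finset.range (a / 2 + 1))
    (fun b => Finset.range (b + 1)) with hJ
  have hsub : Quotient.mk planeCongruence '' trianglesIn (squareGrid N) ⊆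
      ((I.image cornerClass ∪ J.image diagonalClass : Finset _) : Set _) := by
    rintro _ ⟨t, ht, rfl⟩
    obtain ⟨a, b, x, y, hx, hxa, hy, hyb, hab, hb, h⟩ := hasStandardPosition_of_mem_trianglesIn ht
    lift x to ℕ using hx
    lift y to ℕ using hy
    lift a to ℕ using by omega
    lift b to ℕ using by omega
    rw [Finset.mem_coe, Finset.mem_union, Finset.mem_image, Finset.mem_image]
    rcases h with h | ⟨h2, h⟩
    · refine .inl ⟨⟨b, a, x, y⟩, ?_, (Quotient.sound h).symm⟩
      simp only [hI, mem_boxIndex, Finset.mem_range]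
      omega
    · refine .inr ⟨⟨b, a, x, y⟩, ?_, (Quotient.sound h).symm⟩
      simp only [hJ, mem_boxIndex, Finset.mem_range]
      omega
  calc numDistinctTriangles (squareGrid N)
      ≤ (((I.image cornerClass ∪ J.image diagonalClass : Finset _) : Set _)).ncard :=
        Set.ncard_le_ncard hsub (Finset.finite_toSet _)
    _ ≤ I.card + J.card := by
        rw [Set.ncard_coe_finset]
        exact (Finset.card_union_le _ _).trans
          (add_le_add Finset.card_image_le Finset.card_image_le)
    _ = _ := by
        simp only [hI, hJ, card_boxIndex, Finset.card_range]

theorem numDistinctTriangles_upper (N : ℕ) :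
    (numDistinctTriangles (squareGrid N) : ℝ) ≤ 3 / 16 * (N : ℝ) ^ 4 + 10 * (N : ℝ) ^ 3 := by
  -- The summand bounds both families together: `(a + 1) + (a / 2 + 1) ≤ 3 / 2 * a + 2`.
  have hinner : ∀ b : ℕ, ∑ a ∈ Finset.range (b + 1), ((3 / 2 : ℝ) * a + 2) * (b + 1) =
      ((b : ℝ) + 1) ^ 2 * (3 / 4 * b + 2) := by
    intro b
    have h : ∀ m : ℕ, ∑ a ∈ Finset.range m, ((3 / 2 : ℝ) * a + 2) =
        3 / 4 * m * (m - 1) + 2 * m := by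
      intro m
      induction m with
      | zero => simp
      | succ m ih => rw [Finset.sum_range_succ, ih]; push_cast; ring
    rw [← Finset.sum_mul, h]
    push_cast
    ring
  have houter : ∀ m : ℕ, ∑ b ∈ Finset.range m, ((b : ℝ) + 1) ^ 2 * (3 / 4 * b + 2) ≤
      3 / 16 * (m : ℝ) ^ 4 + 10 * (m : ℝ) ^ 3 := by
    intro m
    induction m with
    | zero => simp
    | succ m ih =>
      rw [Finset.sum_range_succ]
      push_cast
      have hm : (0 : ℝ) ≤ m := m.cast_nonneg
      nlinarith [mul_nonneg hm hm]
  refine le_trans ?_ (houter N)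
  calc (numDistinctTriangles (squareGrid N) : ℝ)
      ≤ ((∑ b ∈ Finset.range N, ∑ a ∈ Finset.range (b + 1), (a + 1) * (b + 1) +
      ∑ b ∈ Finset.range N, ∑ a ∈ Finset.range (b + 1), (a / 2 + 1) * (b + 1) : ℕ) : ℝ) := by
        exact_mod_cast numDistinctTriangles_le N
    _ ≤ ∑ b ∈ Finset.range N, ∑ a ∈ Finset.range (b + 1), ((3 / 2 : ℝ) * a + 2) * (b + 1) := by
        push_cast
        rw [← Finset.sum_add_distrib]
        refine Finset.sum_le_sum fun b _ => ?_
        rw [← Finset.sum_add_distrib]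
        refine Finset.sum_le_sum fun a _ => ?_
        have h : ((a / 2 : ℕ) : ℝ) ≤ a / 2 := Nat.cast_div_le
        nlinarith [(b.cast_nonneg : (0 : ℝ) ≤ b)]
    _ = _ := Finset.sum_congr rfl fun b _ => hinner b

/-! ### Points in residue classes and in the lattices `y ≡ c x` -/

/-- A set of natural numbers in `[l, m)` that are congruent to each other modulo `p`. -/
theorem card_le_of_modEq {S : Finset ℕ} {l m p : ℕ} (hlm : l ≤ m)
    (hS : S ⊆ Finset.Ico l m) (h : ∀ x ∈ S, ∀ y ∈ S, (p : ℤ) ∣ x - y) :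
    (S.card : ℝ) ≤ ((m : ℝ) - l) / p + 1 := by
  have hcard : S.card ≤ (Finset.range ((m - l) / p + 1)).card := by
    refine Finset.card_le_card_of_injOn (fun x => (x - l) / p) ?_ ?_
    · intro x hx
      have := Finset.mem_Ico.1 (hS hx)
      simp only [Finset.coe_range, Set.mem_Iio]
      exact Nat.lt_succ_of_le (Nat.div_le_div_right (by omega))
    · intro x hx y hy hxy
      have hx' := Finset.mem_Ico.1 (hS hx)
      have hy' := Finset.mem_Ico.1 (hS hy)
      have hmod : (x - l) % p = (y - l) % p := by
        refine (Nat.modEq_iff_dvd.2 ?_ : x - l ≡ y - l [MOD p])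
        rw [Nat.cast_sub hx'.1, Nat.cast_sub hy'.1, sub_sub_sub_cancel_right]
        exact h y hy x hx
      have h1 := Nat.div_add_mod (x - l) p
      have h2 := Nat.div_add_mod (y - l) p
      simp only at hxy
      rw [hxy, hmod] at h1
      omega
  rw [Finset.card_range] at hcard
  calc (S.card : ℝ) ≤ (((m - l) / p + 1 : ℕ) : ℝ) := by exact_mod_cast hcard
    _ ≤ ((m : ℝ) - l) / p + 1 := by
      push_cast
      rw [← Nat.cast_sub hlm]
      exact add_le_add_left Nat.cast_div_le 1

theorem Int.dvd_of_dvd_mul_of_dvd_sq_add_one {p c z : ℤ} (hc : p ∣ c ^ 2 + 1) (h : p ∣ c * z) :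
    p ∣ z := by
  have : z = (c ^ 2 + 1) * z - c * (c * z) := by ring
  rw [this]
  exact dvd_sub (Dvd.dvd.mul_right hc _) (Dvd.dvd.mul_left h _)

theorem dvd_sq_add_sq_of_dvd {p c x y : ℤ} (hc : p ∣ c ^ 2 + 1) (h : p ∣ y - c * x) :
    p ∣ x ^ 2 + y ^ 2 := by
  have : x ^ 2 + y ^ 2 = (c ^ 2 + 1) * x ^ 2 + (y - c * x) * (y + c * x) := by ring
  rw [this]
  exact dvd_add (dvd_mul_of_dvd_left hc _) (dvd_mul_of_dvd_left h _)

/-- The nonzero points `(x, y)` of the grid with `y ≡ c x [MOD p]`. -/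
def splitPoints (N p c : ℕ) : Finset (ℕ × ℕ) :=
  {z ∈ Finset.range N ×ˢ Finset.range N | z ≠ 0 ∧ (p : ℤ) ∣ z.2 - c * z.1}

/-- The congruence defines a lattice in which every squared length is divisible by `p`, so distinct
points are at distance at least `√p`. Cells of side about `√(p / 2)` thus hold at most one point
each. Leaving out the origin makes the set empty once `p > 2 * N ^ 2`, which is why no additive
error remains. -/
theorem card_splitPoints_le {N p c : ℕ} (hp : 2 ≤ p) (hc : p ∣ c ^ 2 + 1) :
    ((splitPoints N p c).card : ℝ) ≤ 32 * (N : ℝ) ^ 2 / p := by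
  have hc' : (p : ℤ) ∣ (c : ℤ) ^ 2 + 1 := by exact_mod_cast hc
  rcases (splitPoints N p c).eq_empty_or_nonempty with hS | ⟨z, hz⟩
  · rw [hS]; simp; positivity
  have hpN : p ≤ 2 * N ^ 2 := by
    simp only [splitPoints, Finset.mem_filter, Finset.mem_product, Finset.mem_range] at hz
    obtain ⟨⟨h1, h2⟩, h0, hd⟩ := hz
    have hd' : p ∣ z.1 ^ 2 + z.2 ^ 2 := by exact_mod_cast dvd_sq_add_sq_of_dvd hc' hd
    have hpos : 0 < z.1 ^ 2 + z.2 ^ 2 := by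
      rw [Nat.pos_iff_ne_zero]
      intro h
      apply h0
      rw [Nat.add_eq_zero_iff, pow_eq_zero_iff two_ne_zero, pow_eq_zero_iff two_ne_zero] at h
      exact Prod.ext h.1 h.2
    calc p ≤ z.1 ^ 2 + z.2 ^ 2 := Nat.le_of_dvd hpos hd'
      _ ≤ N ^ 2 + N ^ 2 := by gcongr
      _ = 2 * N ^ 2 := by ring
  -- Two integer points in a cell of side `l` differ by at most `l - 1` in each coordinate, and `2 *
  -- (l - 1) ^ 2 < p`. Conversely `p ≤ 8 * l ^ 2`, so `(2 * N / l) ^ 2` cells become `32 * N ^ 2 /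
  -- p`.
  obtain ⟨l, hl⟩ : ∃ l, l = Nat.sqrt (p / 2) := ⟨_, rfl⟩
  have hl1 : l * l ≤ p / 2 := hl ▸ Nat.sqrt_le _
  have hl2 : p / 2 < (l + 1) * (l + 1) := hl ▸ Nat.lt_succ_sqrt _
  have hl0 : 1 ≤ l := by
    by_contra h
    obtain rfl : l = 0 := by omega
    omega
  have hpl : p ≤ 8 * l ^ 2 := by
    have : (l + 1) * (l + 1) ≤ 4 * l ^ 2 := by nlinarith
    omega
  have hlN : l ≤ N := by
    by_contra h
    have : N ^ 2 < l * l := by nlinarith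
    omega
  have hcard : (splitPoints N p c).card ≤
      (Finset.range (N / l + 1) ×ˢ Finset.range (N / l + 1)).card := by
    refine Finset.card_le_card_of_injOn (fun z => (z.1 / l, z.2 / l)) ?_ ?_
    · intro z hz
      simp only [splitPoints, Finset.coe_filter, Finset.mem_product, Finset.mem_range,
        Set.mem_ofPred_eq] at hz
      simp only [Finset.coe_product, Finset.coe_range, Set.mem_prod, Set.mem_Iio]
      exact ⟨Nat.lt_succ_of_le (Nat.div_le_div_right hz.1.1.le),
        Nat.lt_succ_of_le (Nat.div_le_div_right hz.1.2.le)⟩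
    · intro z hz w hw hzw
      simp only [splitPoints, Finset.coe_filter, Set.mem_ofPred_eq] at hz hw
      simp only [Prod.mk.injEq] at hzw
      have close : ∀ s t : ℕ, s / l = t / l → ((s : ℤ) - t) ^ 2 ≤ ((l : ℤ) - 1) ^ 2 := by
        intro s t hst
        have h1 := Nat.div_add_mod s l
        have h2 := Nat.div_add_mod t l
        have h3 := Nat.mod_lt s hl0
        have h4 := Nat.mod_lt t hl0
        rw [hst] at h1
        apply sq_le_sq'
        · omega
        · omega
      have hx := close _ _ hzw.1
      have hy := close _ _ hzw.2
      have hd : (p : ℤ) ∣ ((z.1 : ℤ) - w.1) ^ 2 + ((z.2 : ℤ) - w.2) ^ 2 := by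
        apply dvd_sq_add_sq_of_dvd hc'
        have := dvd_sub hz.2.2 hw.2.2
        rwa [sub_sub_sub_comm, ← mul_sub] at this
      have hlp : 2 * ((l : ℤ) - 1) ^ 2 < p := by
        have h1 : 2 * (l * l) ≤ p := by omega
        have h2 : 2 * ((l : ℤ) * l) ≤ p := by exact_mod_cast h1
        have h3 : (1 : ℤ) ≤ l := by exact_mod_cast hl0
        nlinarith
      have h0 := Int.eq_zero_of_dvd_of_nonneg_of_lt (by positivity) (by linarith) hd
      have hx0 : ((z.1 : ℤ) - w.1) = 0 := by
        nlinarith [sq_nonneg ((z.1 : ℤ) - w.1), sq_nonneg ((z.2 : ℤ) - w.2)]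
      have hy0 : ((z.2 : ℤ) - w.2) = 0 := by
        nlinarith [sq_nonneg ((z.1 : ℤ) - w.1), sq_nonneg ((z.2 : ℤ) - w.2)]
      apply Prod.ext <;> omega
  rw [Finset.card_product, Finset.card_range] at hcard
  have hl0' : (0 : ℝ) < l := by exact_mod_cast hl0
  have hside : ((N / l + 1 : ℕ) : ℝ) ≤ 2 * N / l := by
    have h1 : ((N / l : ℕ) : ℝ) ≤ N / l := Nat.cast_div_le
    have h2 : (1 : ℝ) ≤ N / l := by
      rw [le_div_iff₀ hl0', one_mul]; exact_mod_cast hlN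
    push_cast
    rw [two_mul, add_div]
    linarith
  have hp0 : (0 : ℝ) < p := by exact_mod_cast (by omega : 0 < p)
  calc ((splitPoints N p c).card : ℝ)
      ≤ ((N / l + 1 : ℕ) : ℝ) * ((N / l + 1 : ℕ) : ℝ) := by exact_mod_cast hcard
    _ ≤ (2 * N / l) * (2 * N / l) := by gcongr
    _ = 32 * N ^ 2 / (8 * l ^ 2) := by field_simp; ring
    _ ≤ 32 * N ^ 2 / p := by
      gcongr
      exact_mod_cast hpl

/-- The square roots of `-1` modulo `p`. -/
def sqrtsNegOne (p : ℕ) : Finset ℕ := {c ∈ Finset.range p | p ∣ c ^ 2 + 1}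

theorem card_sqrtsNegOne_le {p : ℕ} (hp : p.Prime) : (sqrtsNegOne p).card ≤ 2 := by
  rcases (sqrtsNegOne p).eq_empty_or_nonempty with hS | ⟨c, hc⟩
  · simp [hS]
  refine (Finset.card_le_card (t := {c, p - c}) ?_).trans Finset.card_le_two
  intro d hd
  simp only [sqrtsNegOne, Finset.mem_filter, Finset.mem_range] at hc hd
  rw [Finset.mem_insert, Finset.mem_singleton]
  have hdvd : (p : ℤ) ∣ ((d : ℤ) - c) * (d + c) := by
    have h1 : (p : ℤ) ∣ (c : ℤ) ^ 2 + 1 := by exact_mod_cast hc.2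
    have h2 : (p : ℤ) ∣ (d : ℤ) ^ 2 + 1 := by exact_mod_cast hd.2
    have := dvd_sub h2 h1
    rwa [add_sub_add_right_eq_sub, sq_sub_sq, mul_comm] at this
  rcases (Nat.prime_iff_prime_int.1 hp).dvd_or_dvd hdvd with ⟨k, hk⟩ | ⟨k, hk⟩
  · left
    have : k < 1 := by nlinarith
    have : -1 < k := by nlinarith
    obtain rfl : k = 0 := by omega
    omega
  · by_cases h0 : d + c = 0
    · omega
    · right
      have : k < 2 := by nlinarith
      have : 0 < k := by
        by_contra h
        have : (p : ℤ) * k ≤ 0 := by nlinarith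
        omega
      obtain rfl : k = 1 := by omega
      omega

/-! ### Counting the exceptional triangles for one prime and one root -/

/-- The indices of the corner triangles in general position. -/
def cornerIndex (N : ℕ) : Finset (Σ _ : ℕ, Σ _ : ℕ, ℕ × ℕ) :=
  boxIndex N Finset.range (fun a => Finset.Ico 1 a) (fun b => Finset.Ico 1 b)

/-- The indices of the diagonal triangles in general position. -/
def diagonalIndex (N : ℕ) : Finset (Σ _ : ℕ, Σ _ : ℕ, ℕ × ℕ) :=
  boxIndex N Finset.range (fun a => Finset.Ico 1 ((a + 1) / 2)) (fun b => Finset.Ico 1 b)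

theorem mem_cornerIndex {N : ℕ} {i : Σ _ : ℕ, Σ _ : ℕ, ℕ × ℕ} :
    i ∈ cornerIndex N ↔ i.1 < N ∧ i.2.1 < i.1 ∧ (1 ≤ i.2.2.1 ∧ i.2.2.1 < i.2.1) ∧
      (1 ≤ i.2.2.2 ∧ i.2.2.2 < i.1) := by
  simp only [cornerIndex, mem_boxIndex, Finset.mem_range, Finset.mem_Ico]

theorem mem_diagonalIndex {N : ℕ} {i : Σ _ : ℕ, Σ _ : ℕ, ℕ × ℕ} :
    i ∈ diagonalIndex N ↔ i.1 < N ∧ i.2.1 < i.1 ∧ (1 ≤ i.2.2.1 ∧ 2 * i.2.2.1 < i.2.1) ∧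
      (1 ≤ i.2.2.2 ∧ i.2.2.2 < i.1) := by
  simp only [diagonalIndex, mem_boxIndex, Finset.mem_range, Finset.mem_Ico]
  omega

/-- The corner triangles whose edge vectors at the corner are divisible by the prime of `ℤ[i]`
given by `p` and `c`. -/
def cornerSplit (N p c : ℕ) : Finset (Σ _ : ℕ, Σ _ : ℕ, ℕ × ℕ) :=
  {i ∈ cornerIndex N | (p : ℤ) ∣ i.2.2.2 - c * i.2.1 ∧ (p : ℤ) ∣ i.1 - c * i.2.2.1}

/-- The diagonal triangles whose edge vectors at the corner are divisible by the prime of `ℤ[i]`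
given by `p` and `c`. -/
def diagonalSplit (N p c : ℕ) : Finset (Σ _ : ℕ, Σ _ : ℕ, ℕ × ℕ) :=
  {i ∈ diagonalIndex N | (p : ℤ) ∣ i.1 - c * i.2.1 ∧ (p : ℤ) ∣ i.2.2.2 - c * i.2.2.1}

theorem card_splitPoints_product_le {N p c : ℕ} (hp : 2 ≤ p) (hc : p ∣ c ^ 2 + 1) :
    (((splitPoints N p c ×ˢ splitPoints N p c).card : ℕ) : ℝ) ≤ 1024 * (N : ℝ) ^ 4 / p ^ 2 := by
  have h := card_splitPoints_le (N := N) hp hc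
  rw [Finset.card_product]
  push_cast
  calc ((splitPoints N p c).card : ℝ) * (splitPoints N p c).card
      ≤ (32 * (N : ℝ) ^ 2 / p) * (32 * (N : ℝ) ^ 2 / p) := by gcongr
    _ = _ := by ring

theorem card_cornerSplit_le_of_large {N p c : ℕ} (hp : 2 ≤ p) (hc : p ∣ c ^ 2 + 1) :
    ((cornerSplit N p c).card : ℝ) ≤ 1024 * (N : ℝ) ^ 4 / p ^ 2 := by
  refine le_trans ?_ (card_splitPoints_product_le hp hc)
  rw [Nat.cast_le]
  refine Finset.card_le_card_of_injOn (fun i => ((i.2.1, i.2.2.2), (i.2.2.1, i.1))) ?_ ?_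
  · intro i hi
    simp only [cornerSplit, Finset.coe_filter, mem_cornerIndex, Set.mem_ofPred_eq] at hi
    simp only [splitPoints, Finset.coe_product, Set.mem_prod, Finset.coe_filter,
      Finset.mem_product, Finset.mem_range, Set.mem_ofPred_eq, ne_eq, Prod.ext_iff, Prod.fst_zero,
      Prod.snd_zero]
    refine ⟨⟨by omega, by omega, hi.2.1⟩, by omega, by omega, hi.2.2⟩
  · rintro ⟨b, a, x, y⟩ - ⟨b', a', x', y'⟩ - h
    simp only [Prod.mk.injEq] at h
    obtain ⟨⟨rfl, rfl⟩, rfl, rfl⟩ := h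
    rfl

theorem card_diagonalSplit_le_of_large {N p c : ℕ} (hp : 2 ≤ p) (hc : p ∣ c ^ 2 + 1) :
    ((diagonalSplit N p c).card : ℝ) ≤ 1024 * (N : ℝ) ^ 4 / p ^ 2 := by
  refine le_trans ?_ (card_splitPoints_product_le hp hc)
  rw [Nat.cast_le]
  refine Finset.card_le_card_of_injOn (fun i => ((i.2.1, i.1), (i.2.2.1, i.2.2.2))) ?_ ?_
  · intro i hi
    simp only [diagonalSplit, Finset.coe_filter, mem_diagonalIndex, Set.mem_ofPred_eq] at hi
    simp only [splitPoints, Finset.coe_product, Set.mem_prod, Finset.coe_filter,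
      Finset.mem_product, Finset.mem_range, Set.mem_ofPred_eq, ne_eq, Prod.ext_iff, Prod.fst_zero,
      Prod.snd_zero]
    refine ⟨⟨by omega, by omega, hi.2.1⟩, by omega, by omega, hi.2.2⟩
  · rintro ⟨b, a, x, y⟩ - ⟨b', a', x', y'⟩ - h
    simp only [Prod.mk.injEq] at h
    obtain ⟨⟨rfl, rfl⟩, rfl, rfl⟩ := h
    rfl

theorem card_filter_dvd_sub_le {l m p : ℕ} (z : ℤ) (hlm : l ≤ m) :
    (({y ∈ Finset.Ico l m | (p : ℤ) ∣ (y : ℤ) - z} : Finset ℕ).card : ℝ) ≤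
      ((m : ℝ) - l) / p + 1 := by
  refine card_le_of_modEq hlm (Finset.filter_subset _ _) fun x hx y hy => ?_
  have := dvd_sub (Finset.mem_filter.1 hx).2 (Finset.mem_filter.1 hy).2
  rwa [sub_sub_sub_cancel_right] at this

theorem card_filter_dvd_sub_mul_le {m p c : ℕ} (z : ℤ) (hc : p ∣ c ^ 2 + 1) :
    (({x ∈ Finset.Ico 0 m | (p : ℤ) ∣ z - c * x} : Finset ℕ).card : ℝ) ≤ (m : ℝ) / p + 1 := by
  have := card_le_of_modEq (S := {x ∈ Finset.Ico 0 m | (p : ℤ) ∣ z - c * x}) (p := p) m.zero_le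
    (Finset.filter_subset _ _) fun x hx y hy => ?_
  · simpa using this
  · apply Int.dvd_of_dvd_mul_of_dvd_sq_add_one (c := c) (by exact_mod_cast hc)
    have := dvd_sub (Finset.mem_filter.1 hy).2 (Finset.mem_filter.1 hx).2
    rwa [sub_sub_sub_cancel_left, ← mul_sub] at this

/-- For fixed `a` and `b` the two congruences put `y` in the class of `c * a` and, as `c` is
invertible, `x` in one class too. The main term is the sum of `a * b / p ^ 2`; the cross terms are
at most `3 * N` for each pair. -/
theorem card_cornerSplit_le {N p c : ℕ} (hp : 0 < p) (hc : p ∣ c ^ 2 + 1) :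
    ((cornerSplit N p c).card : ℝ) ≤ (N : ℝ) ^ 4 / 8 / p ^ 2 + 3 * (N : ℝ) ^ 3 := by
  have hsub : cornerSplit N p c ⊆ (Finset.range N).sigma fun b => (Finset.range b).sigma fun a =>
      ({x ∈ Finset.Ico 0 a | (p : ℤ) ∣ (b : ℤ) - c * (x : ℕ)} : Finset ℕ) ×ˢ
      ({y ∈ Finset.Ico 0 b | (p : ℤ) ∣ ((y : ℕ) : ℤ) - (c * a : ℤ)} : Finset ℕ) := by
    intro i hi
    simp only [cornerSplit, Finset.mem_filter, mem_cornerIndex] at hi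
    simp only [Finset.mem_sigma, Finset.mem_range, Finset.mem_product, Finset.mem_filter,
      Finset.mem_Ico]
    exact ⟨hi.1.1, hi.1.2.1, ⟨⟨Nat.zero_le _, hi.1.2.2.1.2⟩, hi.2.2⟩,
      ⟨Nat.zero_le _, hi.1.2.2.2.2⟩, hi.2.1⟩
  have hp0 : (0 : ℝ) < p := by exact_mod_cast hp
  have hp1 : (1 : ℝ) ≤ p := by exact_mod_cast hp
  have hsum : ∀ m : ℕ, ∑ b ∈ Finset.range m, ∑ a ∈ Finset.range b, (a : ℝ) * b ≤
      (m : ℝ) ^ 4 / 8 := by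
    have h : ∀ m : ℕ, ∑ a ∈ Finset.range m, (a : ℝ) = m * (m - 1) / 2 := by
      intro m
      induction m with
      | zero => simp
      | succ m ih => rw [Finset.sum_range_succ, ih]; push_cast; ring
    intro m
    induction m with
    | zero => simp
    | succ m ih =>
      rw [Finset.sum_range_succ, ← Finset.sum_mul, h]
      push_cast
      have hm : (0 : ℝ) ≤ m := m.cast_nonneg
      nlinarith [mul_nonneg hm hm]
  have hterm : ∀ b ∈ Finset.range N, ∀ a ∈ Finset.range b,
      ((a : ℝ) / p + 1) * ((b : ℝ) / p + 1) ≤ (a : ℝ) * b / p ^ 2 + 3 * N := by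
    intro b hb a ha
    rw [Finset.mem_range] at hb ha
    have hbN : (b : ℝ) + 1 ≤ N := by exact_mod_cast hb
    have hab : (a : ℝ) + 1 ≤ b := by exact_mod_cast ha
    have h1 : (a : ℝ) / p ≤ a := div_le_self a.cast_nonneg hp1
    have h2 : (b : ℝ) / p ≤ b := div_le_self b.cast_nonneg hp1
    have h3 : ((a : ℝ) / p + 1) * ((b : ℝ) / p + 1) =
      (a : ℝ) * b / p ^ 2 + a / p + b / p + 1 := by field_simp; ring
    rw [h3]
    linarith [(a.cast_nonneg : (0 : ℝ) ≤ a)]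
  calc ((cornerSplit N p c).card : ℝ)
      ≤ ∑ b ∈ Finset.range N, ∑ a ∈ Finset.range b, ((a : ℝ) / p + 1) * ((b : ℝ) / p + 1) := by
        refine (Nat.cast_le.2 (Finset.card_le_card hsub)).trans ?_
        rw [Finset.card_sigma]
        push_cast
        refine Finset.sum_le_sum fun b _ => ?_
        rw [Finset.card_sigma]
        push_cast
        refine Finset.sum_le_sum fun a _ => ?_
        rw [Finset.card_product]
        push_cast
        refine mul_le_mul (card_filter_dvd_sub_mul_le _ hc) ?_ (by positivity) (by positivity)
        simpa using card_filter_dvd_sub_le (l := 0) (m := b) (c * a) b.zero_le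
    _ ≤ ∑ b ∈ Finset.range N, ∑ a ∈ Finset.range b, ((a : ℝ) * b / p ^ 2 + 3 * N) :=
        Finset.sum_le_sum fun b hb => Finset.sum_le_sum fun a ha => hterm b hb a ha
    _ = (∑ b ∈ Finset.range N, ∑ a ∈ Finset.range b, (a : ℝ) * b) / p ^ 2 +
        ∑ b ∈ Finset.range N, (b : ℝ) * (3 * N) := by
        simp only [Finset.sum_add_distrib, Finset.sum_div, Finset.sum_const, Finset.card_range,
          nsmul_eq_mul]
    _ ≤ (N : ℝ) ^ 4 / 8 / p ^ 2 + ∑ b ∈ Finset.range N, (N : ℝ) * (3 * N) := by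
        refine add_le_add (div_le_div_of_nonneg_right (hsum N) (by positivity)) ?_
        refine Finset.sum_le_sum fun b hb => ?_
        have : (b : ℝ) ≤ N := by exact_mod_cast (Finset.mem_range.1 hb).le
        gcongr
    _ = _ := by
        rw [Finset.sum_const, Finset.card_range, nsmul_eq_mul]; ring

/-- Here the congruences tie `b` to `a` and `y` to `x`, so `a` and `x` are fixed first. Relaxing `y
< b` to `y < N` decouples the two counts, at the price of `1/12` in place of `1/16`. -/
theorem card_diagonalSplit_le {N p c : ℕ} (hp : 0 < p) :
    ((diagonalSplit N p c).card : ℝ) ≤ (N : ℝ) ^ 4 / 12 / p ^ 2 + 2 * (N : ℝ) ^ 3 := by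
  have hcard : (diagonalSplit N p c).card ≤ ((Finset.range N).sigma fun a =>
      (Finset.Ico 1 ((a + 1) / 2)).sigma fun x =>
      ({b ∈ Finset.Ico a N | (p : ℤ) ∣ ((b : ℕ) : ℤ) - (c * a : ℤ)} : Finset ℕ) ×ˢ
      ({y ∈ Finset.Ico 0 N | (p : ℤ) ∣ ((y : ℕ) : ℤ) - (c * x : ℤ)} : Finset ℕ)).card := by
    refine Finset.card_le_card_of_injOn (fun i => ⟨i.2.1, i.2.2.1, i.1, i.2.2.2⟩) ?_ ?_
    · intro i hi
      simp only [diagonalSplit, Finset.coe_filter, mem_diagonalIndex, Set.mem_ofPred_eq] at hi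
      simp only [Finset.mem_coe, Finset.mem_sigma, Finset.mem_range, Finset.mem_product,
        Finset.mem_filter, Finset.mem_Ico]
      refine ⟨by omega, by omega, ⟨by omega, hi.2.1⟩, by omega, hi.2.2⟩
    · rintro ⟨b, a, x, y⟩ - ⟨b', a', x', y'⟩ - h
      simp only [Sigma.mk.injEq, heq_eq_eq, Prod.mk.injEq] at h
      obtain ⟨rfl, rfl, rfl, rfl⟩ := h
      rfl
  have hp0 : (0 : ℝ) < p := by exact_mod_cast hp
  have hp1 : (1 : ℝ) ≤ p := by exact_mod_cast hp
  have hsum : ∑ a ∈ Finset.range N, (a : ℝ) * (N - a) ≤ (N : ℝ) ^ 3 / 6 := by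
    have h : ∀ m : ℕ, ∑ a ∈ Finset.range m, (a : ℝ) * (N - a) =
        N * (m * (m - 1) / 2) - m * (m - 1) * (2 * m - 1) / 6 := by
      intro m
      induction m with
      | zero => simp
      | succ m ih => rw [Finset.sum_range_succ, ih]; push_cast; ring
    rw [h]
    nlinarith [(N.cast_nonneg : (0 : ℝ) ≤ N)]
  have hterm : ∀ a ∈ Finset.range N, (a : ℝ) / 2 * ((((N : ℝ) - a) / p + 1) * ((N : ℝ) / p + 1)) ≤
      (a : ℝ) * (N - a) * (N / 2 / p ^ 2) + 2 * (N : ℝ) ^ 2 := by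
    intro a ha
    rw [Finset.mem_range] at ha
    have haN : (a : ℝ) + 1 ≤ N := by exact_mod_cast ha
    have ha0 : (0 : ℝ) ≤ a := a.cast_nonneg
    have h1 : ((N : ℝ) - a) / p ≤ N - a := div_le_self (by linarith) hp1
    have h2 : (N : ℝ) / p ≤ N := div_le_self N.cast_nonneg hp1
    have h3 : (a : ℝ) / 2 * ((((N : ℝ) - a) / p + 1) * ((N : ℝ) / p + 1)) =
      (a : ℝ) * (N - a) * (N / 2 / p ^ 2) + a / 2 * ((N - a) / p + N / p + 1) := by
      field_simp; ring
    rw [h3]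
    have h4 : (a : ℝ) / 2 * (((N : ℝ) - a) / p + N / p + 1) ≤ N / 2 * (4 * N) := by
      apply mul_le_mul
      · linarith
      · linarith
      · have : 0 ≤ ((N : ℝ) - a) / p := div_nonneg (by linarith) hp0.le
        positivity
      · positivity
    linarith
  calc ((diagonalSplit N p c).card : ℝ)
      ≤ ∑ a ∈ Finset.range N, (a : ℝ) / 2 * ((((N : ℝ) - a) / p + 1) * ((N : ℝ) / p + 1)) := by
        refine (Nat.cast_le.2 hcard).trans ?_
        rw [Finset.card_sigma]
        push_cast
        refine Finset.sum_le_sum fun a ha => ?_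
        rw [Finset.mem_range] at ha
        have haN : (a : ℝ) ≤ N := by exact_mod_cast ha.le
        have hX : ((Finset.Ico 1 ((a + 1) / 2)).card : ℝ) ≤ a / 2 := by
          rw [Nat.card_Ico, le_div_iff₀ two_pos]
          exact_mod_cast (by omega : ((a + 1) / 2 - 1) * 2 ≤ a)
        have hnn : 0 ≤ ((N : ℝ) - a) / p + 1 := by
          have : 0 ≤ ((N : ℝ) - a) / p := div_nonneg (by linarith) hp0.le
          linarith
        rw [Finset.card_sigma]
        push_cast
        calc _ ≤ ∑ x ∈ Finset.Ico 1 ((a + 1) / 2),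
              (((N : ℝ) - a) / p + 1) * ((N : ℝ) / p + 1) := by
              refine Finset.sum_le_sum fun x _ => ?_
              rw [Finset.card_product]
              push_cast
              refine mul_le_mul (card_filter_dvd_sub_le _ ha.le) ?_ (by positivity) hnn
              simpa using card_filter_dvd_sub_le (l := 0) (m := N) (c * x) N.zero_le
          _ ≤ _ := by
              rw [Finset.sum_const, nsmul_eq_mul]
              exact mul_le_mul_of_nonneg_right hX (mul_nonneg hnn (by positivity))
    _ ≤ ∑ a ∈ Finset.range N, ((a : ℝ) * (N - a) * (N / 2 / p ^ 2) + 2 * (N : ℝ) ^ 2) :=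
        Finset.sum_le_sum hterm
    _ = (∑ a ∈ Finset.range N, (a : ℝ) * (N - a)) * (N / 2 / p ^ 2) + 2 * (N : ℝ) ^ 3 := by
        rw [Finset.sum_add_distrib, Finset.sum_mul, Finset.sum_const, Finset.card_range,
          nsmul_eq_mul]
        ring
    _ ≤ (N : ℝ) ^ 3 / 6 * (N / 2 / p ^ 2) + 2 * (N : ℝ) ^ 3 := by gcongr
    _ = _ := by ring

/-! ### Summation over the primes -/

/-- The primes `p ≡ 1 [MOD 4]` below `M`. -/
def splitPrimes (M : ℕ) : Finset ℕ := {p ∈ Finset.range M | p.Prime ∧ p % 4 = 1}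

/-- Telescoping, from `(4k - 1)(4k + 3) < (4k + 1) ^ 2`; the first term of the telescope at `k = 3`
is `1/44`. -/
theorem sum_inv_sq_four_mul_add_one_le (m : ℕ) (hm : 3 ≤ m) :
    ∑ k ∈ Finset.Ico 3 m, 1 / (((4 * k + 1 : ℕ) : ℝ)) ^ 2 ≤
      1 / 44 - 1 / (4 * (4 * (m : ℝ) - 1)) := by
  induction m, hm using Nat.le_induction with
  | base => norm_num
  | succ m hm ih =>
    rw [Finset.sum_Ico_succ_top hm]
    have hm' : (3 : ℝ) ≤ m := by exact_mod_cast hm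
    have key : 1 / (((4 * m + 1 : ℕ) : ℝ)) ^ 2 ≤
        1 / (4 * (4 * (m : ℝ) - 1)) - 1 / (4 * (4 * ((m + 1 : ℕ) : ℝ) - 1)) := by
      push_cast
      rw [div_sub_div _ _ (by linarith) (by linarith), div_le_div_iff₀ (by positivity)
        (mul_pos (by linarith) (by linarith))]
      nlinarith
    linarith

theorem sum_splitPrimes_inv_sq_le (S : Finset ℕ) (hS : ∀ p ∈ S, p.Prime ∧ p % 4 = 1) :
    ∑ p ∈ S, 1 / (p : ℝ) ^ 2 ≤ (1 / 25 + 1 / 44 : ℝ) := by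
  set m := S.sup id + 3 with hm
  obtain ⟨T, hT⟩ : ∃ T : Finset ℕ, T = insert 5 ((Finset.Ico 3 m).image fun k => 4 * k + 1) :=
    ⟨_, rfl⟩
  have hsub : S ⊆ T := by
    intro p hp
    obtain ⟨h1, h2⟩ := hS p hp
    have hle : p ≤ S.sup id := Finset.le_sup (f := id) hp
    rw [hT, Finset.mem_insert, Finset.mem_image]
    by_cases h5 : p = 5
    · exact .inl h5
    · refine .inr ⟨p / 4, Finset.mem_Ico.2 ⟨?_, by omega⟩, by omega⟩
      -- Apart from 5, the only candidates below 13 are 1 and 9, which are not prime.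
      by_contra h
      have : p = 1 ∨ p = 9 := by omega
      rcases this with rfl | rfl <;> norm_num at h1
  calc ∑ p ∈ S, 1 / (p : ℝ) ^ 2
      ≤ ∑ p ∈ T, 1 / (p : ℝ) ^ 2 :=
        Finset.sum_le_sum_of_subset_of_nonneg hsub fun _ _ _ => by positivity
    _ = (1 / 25 : ℝ) + (∑ k ∈ Finset.Ico 3 m, 1 / (((4 * k + 1 : ℕ) : ℝ)) ^ 2 : ℝ) := by
        rw [hT, Finset.sum_insert, Finset.sum_image]
        · norm_num
        · intro a _ b _ h
          simp only at h
          omega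
        · simp only [Finset.mem_image, Finset.mem_Ico]
          rintro ⟨k, hk, hk'⟩
          omega
    _ ≤ (1 / 25 + 1 / 44 : ℝ) := by
        have h := sum_inv_sq_four_mul_add_one_le m (by omega)
        have hm3 : (3 : ℝ) ≤ m := by exact_mod_cast (by omega : 3 ≤ m)
        have : 0 ≤ 1 / (4 * (4 * (m : ℝ) - 1)) := by
          apply div_nonneg zero_le_one; linarith
        linarith

theorem sum_inv_sq_le_of_lt (S : Finset ℕ) (K : ℕ) (hK : 0 < K) (hS : ∀ p ∈ S, K < p) :
    ∑ p ∈ S, 1 / (p : ℝ) ^ 2 ≤ (1 / K : ℝ) := by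
  set m := S.sup id + K with hm
  have hsub : S ⊆ Finset.Ioc K m := by
    intro p hp
    have hle : p ≤ S.sup id := Finset.le_sup (f := id) hp
    exact Finset.mem_Ioc.2 ⟨hS p hp, by omega⟩
  calc ∑ p ∈ S, 1 / (p : ℝ) ^ 2 ≤ ∑ p ∈ Finset.Ioc K m, 1 / (p : ℝ) ^ 2 :=
        Finset.sum_le_sum_of_subset_of_nonneg hsub fun _ _ _ => by positivity
    _ ≤ (K : ℝ)⁻¹ - (m : ℝ)⁻¹ := by
        simp only [one_div]
        exact sum_Ioc_inv_sq_le_sub hK.ne' (by omega)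
    _ ≤ (1 / K : ℝ) := by
        have : (0 : ℝ) ≤ (m : ℝ)⁻¹ := by positivity
        rw [one_div]; linarith

/-- The cutoff `10 ^ 6` does not depend on `N`. Below it the cubic errors occur boundedly often;
above it the packing bound applies, with `4096 = 2 * 2 * 1024` for two roots and two families, and
the tail of `∑ 1/p ^ 2` is at most `1 / 10 ^ 6`. -/
theorem sum_card_split_le (N M : ℕ) :
    ∑ p ∈ splitPrimes M, ∑ c ∈ sqrtsNegOne p,
      (((cornerSplit N p c).card : ℝ) + (diagonalSplit N p c).card) ≤
      (5 / 12 * (1 / 25 + 1 / 44) + 4096 / 10 ^ 6) * (N : ℝ) ^ 4 +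
        10 * (10 ^ 6 + 1) * (N : ℝ) ^ 3 := by
  have hmem : ∀ p ∈ splitPrimes M, p.Prime ∧ p % 4 = 1 := fun p hp => (Finset.mem_filter.1 hp).2
  have hroots : ∀ p ∈ splitPrimes M, ∀ B : ℝ, 0 ≤ B →
      (∀ c ∈ sqrtsNegOne p, ((cornerSplit N p c).card : ℝ) + (diagonalSplit N p c).card ≤ B) →
      ∑ c ∈ sqrtsNegOne p, (((cornerSplit N p c).card : ℝ) + (diagonalSplit N p c).card) ≤
        2 * B := by
    intro p hp B hB h
    refine (Finset.sum_le_card_nsmul _ _ B h).trans ?_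
    rw [nsmul_eq_mul]
    have : ((sqrtsNegOne p).card : ℝ) ≤ 2 := by exact_mod_cast card_sqrtsNegOne_le (hmem p hp).1
    gcongr
  rw [← Finset.sum_filter_add_sum_filter_not (splitPrimes M) (fun p => p ≤ 10 ^ 6)]
  have hsmall : ∑ p ∈ splitPrimes M with p ≤ 10 ^ 6, ∑ c ∈ sqrtsNegOne p,
      (((cornerSplit N p c).card : ℝ) + (diagonalSplit N p c).card) ≤
      5 / 12 * (N : ℝ) ^ 4 * (1 / 25 + 1 / 44) + 10 * (10 ^ 6 + 1) * (N : ℝ) ^ 3 := by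
    calc _ ≤ ∑ p ∈ splitPrimes M with p ≤ 10 ^ 6,
          (5 / 12 * (N : ℝ) ^ 4 * (1 / (p : ℝ) ^ 2) + 10 * (N : ℝ) ^ 3) := by
          refine Finset.sum_le_sum fun p hp => ?_
          have hp := (Finset.mem_filter.1 hp).1
          have hp0 := (hmem p hp).1.pos
          refine (hroots p hp ((N : ℝ) ^ 4 / 8 / p ^ 2 + 3 * (N : ℝ) ^ 3 +
            ((N : ℝ) ^ 4 / 12 / p ^ 2 + 2 * (N : ℝ) ^ 3)) (by positivity) fun c hc =>
            add_le_add (card_cornerSplit_le hp0 (Finset.mem_filter.1 hc).2)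
              (card_diagonalSplit_le hp0)).trans (le_of_eq ?_)
          ring
      _ = 5 / 12 * (N : ℝ) ^ 4 * (∑ p ∈ splitPrimes M with p ≤ 10 ^ 6, 1 / (p : ℝ) ^ 2) +
          ((splitPrimes M).filter (fun p => p ≤ 10 ^ 6)).card * (10 * (N : ℝ) ^ 3) := by
          rw [Finset.sum_add_distrib, Finset.mul_sum, Finset.sum_const, nsmul_eq_mul]
      _ ≤ 5 / 12 * (N : ℝ) ^ 4 * (1 / 25 + 1 / 44) + (10 ^ 6 + 1) * (10 * (N : ℝ) ^ 3) := by
          have h1 := sum_splitPrimes_inv_sq_le ((splitPrimes M).filter (fun p => p ≤ 10 ^ 6))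
            fun p hp => hmem p (Finset.mem_filter.1 hp).1
          have h2 : ((splitPrimes M).filter (fun p => p ≤ 10 ^ 6)).card ≤
              (Finset.range (10 ^ 6 + 1)).card := by
            refine Finset.card_le_card fun p hp => ?_
            exact Finset.mem_range.2 (Nat.lt_succ_of_le (Finset.mem_filter.1 hp).2)
          rw [Finset.card_range] at h2
          have h3 : (((splitPrimes M).filter (fun p => p ≤ 10 ^ 6)).card : ℝ) ≤ 10 ^ 6 + 1 := by
            exact_mod_cast h2
          gcongr
      _ = _ := by ring
  have hlarge : ∑ p ∈ splitPrimes M with ¬ p ≤ 10 ^ 6, ∑ c ∈ sqrtsNegOne p,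
      (((cornerSplit N p c).card : ℝ) + (diagonalSplit N p c).card) ≤
      4096 * (N : ℝ) ^ 4 * (1 / 10 ^ 6) := by
    calc _ ≤ ∑ p ∈ splitPrimes M with ¬ p ≤ 10 ^ 6, 4096 * (N : ℝ) ^ 4 * (1 / (p : ℝ) ^ 2) := by
          refine Finset.sum_le_sum fun p hp => ?_
          have hp := (Finset.mem_filter.1 hp).1
          have hp2 := (hmem p hp).1.two_le
          refine (hroots p hp (1024 * (N : ℝ) ^ 4 / p ^ 2 + 1024 * (N : ℝ) ^ 4 / p ^ 2)
            (by positivity) fun c hc => add_le_add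
              (card_cornerSplit_le_of_large hp2 (Finset.mem_filter.1 hc).2)
              (card_diagonalSplit_le_of_large hp2 (Finset.mem_filter.1 hc).2)).trans (le_of_eq ?_)
          ring
      _ ≤ 4096 * (N : ℝ) ^ 4 * (1 / 10 ^ 6) := by
          rw [← Finset.mul_sum]
          have h := sum_inv_sq_le_of_lt ((splitPrimes M).filter (fun p => ¬ p ≤ 10 ^ 6)) (10 ^ 6)
            (by norm_num) fun p hp => not_le.1 (Finset.mem_filter.1 hp).2
          rw [Nat.cast_pow, Nat.cast_ofNat] at h
          exact mul_le_mul_of_nonneg_left h (by positivity)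
  linarith

/-- This confines the union over `p` to finitely many primes. -/
theorem lt_of_dvd_sub_mul {N p c x y : ℕ} (hc : p ∣ c ^ 2 + 1) (hx : 0 < x) (hxN : x < N)
    (hyN : y < N) (h : (p : ℤ) ∣ y - c * x) : p < 2 * N ^ 2 := by
  have hd : p ∣ x ^ 2 + y ^ 2 := by
    exact_mod_cast dvd_sq_add_sq_of_dvd (by exact_mod_cast hc : (p : ℤ) ∣ (c : ℤ) ^ 2 + 1) h
  calc p ≤ x ^ 2 + y ^ 2 := Nat.le_of_dvd (by positivity) hd
    _ < N ^ 2 + N ^ 2 := by gcongr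
    _ = 2 * N ^ 2 := by ring

open Classical in
theorem card_filter_hasSplitDivisor_corner_le (N : ℕ) :
    ((cornerIndex N).filter fun i => HasSplitDivisor i.2.1 i.2.2.2 i.2.2.1 i.1).card ≤
      ∑ p ∈ splitPrimes (2 * N ^ 2), ∑ c ∈ sqrtsNegOne p, (cornerSplit N p c).card := by
  refine (Finset.card_le_card (t := (splitPrimes (2 * N ^ 2)).biUnion fun p =>
    (sqrtsNegOne p).biUnion fun c => cornerSplit N p c) ?_).trans
    (Finset.card_biUnion_le.trans (Finset.sum_le_sum fun p _ => Finset.card_biUnion_le))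
  intro i hi
  obtain ⟨hi, p, c, hp, hp4, hc, hpc, h1, h2⟩ := Finset.mem_filter.1 hi
  have hi' := mem_cornerIndex.1 hi
  simp only [Finset.mem_biUnion, splitPrimes, sqrtsNegOne, cornerSplit, Finset.mem_filter,
    Finset.mem_range]
  exact ⟨p, ⟨lt_of_dvd_sub_mul hpc (by omega) (by omega) (by omega) h1, hp, hp4⟩, c, ⟨hc, hpc⟩,
    hi, h1, h2⟩

open Classical in
theorem card_filter_hasSplitDivisor_diagonal_le (N : ℕ) :
    ((diagonalIndex N).filter fun i => HasSplitDivisor i.2.1 i.1 i.2.2.1 i.2.2.2).card ≤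
      ∑ p ∈ splitPrimes (2 * N ^ 2), ∑ c ∈ sqrtsNegOne p, (diagonalSplit N p c).card := by
  refine (Finset.card_le_card (t := (splitPrimes (2 * N ^ 2)).biUnion fun p =>
    (sqrtsNegOne p).biUnion fun c => diagonalSplit N p c) ?_).trans
    (Finset.card_biUnion_le.trans (Finset.sum_le_sum fun p _ => Finset.card_biUnion_le))
  intro i hi
  obtain ⟨hi, p, c, hp, hp4, hc, hpc, h1, h2⟩ := Finset.mem_filter.1 hi
  have hi' := mem_diagonalIndex.1 hi
  simp only [Finset.mem_biUnion, splitPrimes, sqrtsNegOne, diagonalSplit, Finset.mem_filter,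
    Finset.mem_range]
  exact ⟨p, ⟨lt_of_dvd_sub_mul hpc (by omega) (by omega) (by omega) h1, hp, hp4⟩, c, ⟨hc, hpc⟩,
    hi, h1, h2⟩

/-! ### The lower bound -/

theorem latticeTriangle_mem_trianglesIn {N : ℕ} {p q r : ℤ × ℤ} (hp : 0 ≤ p.1 ∧ p.1 < N)
    (hp' : 0 ≤ p.2 ∧ p.2 < N) (hq : 0 ≤ q.1 ∧ q.1 < N) (hq' : 0 ≤ q.2 ∧ q.2 < N)
    (hr : 0 ≤ r.1 ∧ r.1 < N) (hr' : 0 ≤ r.2 ∧ r.2 < N) (hpq : p ≠ q) (hpr : p ≠ r) (hqr : q ≠ r) :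
    latticeTriangle p q r ∈ trianglesIn (squareGrid N) := by
  refine ⟨?_, ?_⟩
  · rintro x (rfl | rfl | rfl)
    · exact mem_squareGrid_iff.2 ⟨p, hp, hp', rfl⟩
    · exact mem_squareGrid_iff.2 ⟨q, hq, hq', rfl⟩
    · exact mem_squareGrid_iff.2 ⟨r, hr, hr', rfl⟩
  · exact Set.ncard_eq_three.2 ⟨_, _, _, latticePoint_injective.ne hpq,
      latticePoint_injective.ne hpr, latticePoint_injective.ne hqr, rfl⟩

-- Both families of unexceptional triangles inject into the congruence classes, and their images are
-- disjoint.
open Classical in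
theorem le_numDistinctTriangles (N : ℕ) :
    ((cornerIndex N).filter fun i => ¬ HasSplitDivisor i.2.1 i.2.2.2 i.2.2.1 i.1).card +
      ((diagonalIndex N).filter fun i => ¬ HasSplitDivisor i.2.1 i.1 i.2.2.1 i.2.2.2).card ≤
      numDistinctTriangles (squareGrid N) := by
  set I := (cornerIndex N).filter fun i => ¬ HasSplitDivisor i.2.1 i.2.2.2 i.2.2.1 i.1 with hI
  set J := (diagonalIndex N).filter fun i => ¬ HasSplitDivisor i.2.1 i.1 i.2.2.1 i.2.2.2 with hJ
  have hIinj : Set.InjOn cornerClass I := by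
    rintro ⟨b, a, x, y⟩ hi ⟨b', a', x', y'⟩ hj h
    simp only [hI, Finset.coe_filter, mem_cornerIndex, Set.mem_ofPred_eq] at hi hj
    have h' : planeCongruence (cornerTriangle a b x y) (cornerTriangle a' b' x' y') := Quotient.exact h
    obtain ⟨h1, h2, h3, h4⟩ := cornerTriangle_inj (by omega) (by omega) (by omega) (by omega)
      (by omega) (by omega) (by omega) (by omega) (by omega) (by omega) hi.2 h'
    simp only [Nat.cast_inj] at h1 h2 h3 h4
    subst h1 h2 h3 h4
    rfl
  have hJinj : Set.InjOn diagonalClass J := by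
    rintro ⟨b, a, x, y⟩ hi ⟨b', a', x', y'⟩ hj h
    simp only [hJ, Finset.coe_filter, mem_diagonalIndex, Set.mem_ofPred_eq] at hi hj
    have h' : planeCongruence (diagonalTriangle a b x y) (diagonalTriangle a' b' x' y') := Quotient.exact h
    obtain ⟨h1, h2, h3, h4⟩ := diagonalTriangle_inj (by omega) (by omega) (by omega) (by omega)
      (by omega) (by omega) (by omega) (by omega) (by omega) (by omega) hi.2 h'
    simp only [Nat.cast_inj] at h1 h2 h3 h4
    subst h1 h2 h3 h4
    rfl
  have hdisj : Disjoint (I.image cornerClass) (J.image diagonalClass) := by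
    rw [Finset.disjoint_left]
    intro q hq hq'
    obtain ⟨⟨b, a, x, y⟩, hi, rfl⟩ := Finset.mem_image.1 hq
    obtain ⟨⟨b', a', x', y'⟩, hj, h⟩ := Finset.mem_image.1 hq'
    simp only [hI, Finset.mem_filter, mem_cornerIndex] at hi
    simp only [hJ, Finset.mem_filter, mem_diagonalIndex] at hj
    have h' : planeCongruence (cornerTriangle a b x y) (diagonalTriangle a' b' x' y') :=
      Quotient.exact h.symm
    exact not_planeCongruence_corner_diagonal (by omega) (by omega) (by omega) (by omega)
      (by omega) (by omega) (by omega) (by omega) (by omega) (by omega) hi.2 h'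
  have hsub : ((I.image cornerClass ∪ J.image diagonalClass : Finset _) : Set _) ⊆
      Quotient.mk planeCongruence '' trianglesIn (squareGrid N) := by
    intro q hq
    rw [Finset.mem_coe, Finset.mem_union, Finset.mem_image, Finset.mem_image] at hq
    rcases hq with ⟨⟨b, a, x, y⟩, hi, rfl⟩ | ⟨⟨b, a, x, y⟩, hi, rfl⟩
    · simp only [hI, Finset.mem_filter, mem_cornerIndex] at hi
      refine ⟨_, latticeTriangle_mem_trianglesIn ?_ ?_ ?_ ?_ ?_ ?_ ?_ ?_ ?_, rfl⟩ <;>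
        simp only [ne_eq, Prod.mk.injEq] <;> omega
    · simp only [hJ, Finset.mem_filter, mem_diagonalIndex] at hi
      refine ⟨_, latticeTriangle_mem_trianglesIn ?_ ?_ ?_ ?_ ?_ ?_ ?_ ?_ ?_, rfl⟩ <;>
        simp only [ne_eq, Prod.mk.injEq] <;> omega
  have hfin : (Quotient.mk planeCongruence '' trianglesIn (squareGrid N)).Finite :=
    ((squareGrid_finite N).finite_subsets.subset fun t ht => ht.1).image _
  calc I.card + J.card = (I.image cornerClass ∪ J.image diagonalClass).card := by
        rw [Finset.card_union_of_disjoint hdisj, Finset.card_image_of_injOn hIinj,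
          Finset.card_image_of_injOn hJinj]
    _ ≤ numDistinctTriangles (squareGrid N) := by
        rw [← Set.ncard_coe_finset]
        exact Set.ncard_le_ncard hsub hfin

/-- General position costs only `O(N ^ 3)`, so the main term agrees with the upper bound. -/
theorem le_card_cornerIndex_add_card_diagonalIndex (N : ℕ) :
    3 / 16 * (N : ℝ) ^ 4 - 10 * (N : ℝ) ^ 3 ≤
      ((cornerIndex N).card : ℝ) + (diagonalIndex N).card := by
  have hinner : ∀ b : ℕ, ∑ a ∈ Finset.range b, ((3 / 2 : ℝ) * a - 2) * (b - 1) =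
      (3 / 4 * b * (b - 1) - 2 * b) * (b - 1) := by
    intro b
    have h : ∀ m : ℕ, ∑ a ∈ Finset.range m, ((3 / 2 : ℝ) * a - 2) =
        3 / 4 * m * (m - 1) - 2 * m := by
      intro m
      induction m with
      | zero => simp
      | succ m ih => rw [Finset.sum_range_succ, ih]; push_cast; ring
    rw [← Finset.sum_mul, h]
  have houter : ∀ m : ℕ, 3 / 16 * (m : ℝ) ^ 4 - 10 * (m : ℝ) ^ 3 ≤
      ∑ b ∈ Finset.range m, (3 / 4 * (b : ℝ) * (b - 1) - 2 * b) * (b - 1) := by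
    intro m
    induction m with
    | zero => simp
    | succ m ih =>
      rw [Finset.sum_range_succ]
      push_cast
      have hm : (0 : ℝ) ≤ m := m.cast_nonneg
      nlinarith [mul_nonneg hm hm]
  refine (houter N).trans ?_
  simp only [cornerIndex, diagonalIndex, card_boxIndex, Nat.card_Ico]
  push_cast
  rw [← Finset.sum_add_distrib]
  refine Finset.sum_le_sum fun b _ => ?_
  rw [← hinner, ← Finset.sum_add_distrib]
  refine Finset.sum_le_sum fun a ha => ?_
  rw [Finset.mem_range] at ha
  have hb : ((b - 1 : ℕ) : ℝ) = b - 1 := by rw [Nat.cast_sub (by omega), Nat.cast_one]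
  have hb0 : (0 : ℝ) ≤ b - 1 := hb ▸ Nat.cast_nonneg _
  have h1 : (a : ℝ) - 1 ≤ ((a - 1 : ℕ) : ℝ) := by
    rw [sub_le_iff_le_add]; exact_mod_cast (by omega : a ≤ a - 1 + 1)
  have h2 : (a : ℝ) / 2 - 1 ≤ (((a + 1) / 2 - 1 : ℕ) : ℝ) := by
    have : (a : ℝ) ≤ 2 * (((a + 1) / 2 - 1 : ℕ) : ℝ) + 2 := by
      exact_mod_cast (by omega : a ≤ 2 * ((a + 1) / 2 - 1) + 2)
    linarith
  rw [hb, ← add_mul]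
  exact mul_le_mul_of_nonneg_right (by linarith) hb0

/-- Numerically, `3/16 - 5/12 * (1/25 + 1/44) - 4096 / 10 ^ 6 > 0.157`, and `10000020 = 10 * (10 ^ 6
+ 1) + 10`. -/
theorem numDistinctTriangles_lower (N : ℕ) :
    0.1558 * (N : ℝ) ^ 4 - 10000020 * (N : ℝ) ^ 3 ≤
      (numDistinctTriangles (squareGrid N) : ℝ) := by
  classical
  have h1 := Finset.card_filter_add_card_filter_not (s := cornerIndex N)
    (fun i => HasSplitDivisor i.2.1 i.2.2.2 i.2.2.1 i.1)
  have h2 := Finset.card_filter_add_card_filter_not (s := diagonalIndex N)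
    (fun i => HasSplitDivisor i.2.1 i.1 i.2.2.1 i.2.2.2)
  have h3 := card_filter_hasSplitDivisor_corner_le N
  have h4 := card_filter_hasSplitDivisor_diagonal_le N
  have h5 := le_numDistinctTriangles N
  have h6 := le_card_cornerIndex_add_card_diagonalIndex N
  have h7 := sum_card_split_le N (2 * N ^ 2)
  simp only [Finset.sum_add_distrib] at h7
  have h8 : (cornerIndex N).card + (diagonalIndex N).card ≤
      numDistinctTriangles (squareGrid N) +
      (∑ p ∈ splitPrimes (2 * N ^ 2), ∑ c ∈ sqrtsNegOne p, (cornerSplit N p c).card +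
      ∑ p ∈ splitPrimes (2 * N ^ 2), ∑ c ∈ sqrtsNegOne p, (diagonalSplit N p c).card) := by
    omega
  have h9 : ((cornerIndex N).card : ℝ) + (diagonalIndex N).card ≤
      numDistinctTriangles (squareGrid N) +
      (∑ p ∈ splitPrimes (2 * N ^ 2), ∑ c ∈ sqrtsNegOne p, ((cornerSplit N p c).card : ℝ) +
      ∑ p ∈ splitPrimes (2 * N ^ 2), ∑ c ∈ sqrtsNegOne p, ((diagonalSplit N p c).card : ℝ)) := by
    exact_mod_cast h8
  have hN : (0 : ℝ) ≤ (N : ℝ) ^ 4 := by positivity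
  linarith

/-! ### The asymptotic statement -/

theorem isLittleO_const_mul_rpow_three_halves (C : ℝ) :
    Asymptotics.IsLittleO Filter.atTop (fun n : ℕ => C * (n : ℝ) ^ (3 / 2 : ℝ))
      (fun n : ℕ => (n : ℝ) ^ 2) := by
  refine Asymptotics.IsLittleO.const_mul_left ?_ C
  refine Asymptotics.isLittleO_of_tendsto' ?_ ?_
  · filter_upwards [Filter.eventually_gt_atTop 0] with n hn h
    exact absurd h (by positivity)
  · refine ((tendsto_rpow_neg_atTop (y := 1 / 2) (by norm_num)).comp
      tendsto_natCast_atTop_atTop).congr' ?_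
    filter_upwards [Filter.eventually_gt_atTop 0] with n hn
    have hn' : (0 : ℝ) < n := by exact_mod_cast hn
    rw [Function.comp_apply, ← Real.rpow_natCast, ← Real.rpow_sub hn']
    norm_num

theorem theorem1p2 :
    ∃ e₁ e₂ : ℕ → ℝ,
      Asymptotics.IsLittleO Filter.atTop e₁ (fun n : ℕ => (n : ℝ) ^ 2) ∧
      Asymptotics.IsLittleO Filter.atTop e₂ (fun n : ℕ => (n : ℝ) ^ 2) ∧
      ∀ n N : ℕ, n = N ^ 2 →
        0.1558 * (n : ℝ) ^ 2 + e₁ n ≤ (numDistinctTriangles (squareGrid N) : ℝ) ∧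
        (numDistinctTriangles (squareGrid N) : ℝ) ≤ 0.1875 * (n : ℝ) ^ 2 + e₂ n := by
  -- The errors are multiples of `N ^ 3 = n ^ (3 / 2)`.
  refine ⟨_, _, isLittleO_const_mul_rpow_three_halves (-10000020),
    isLittleO_const_mul_rpow_three_halves 10, ?_⟩
  rintro _ N rfl
  have hpow : (((N ^ 2 : ℕ) : ℝ)) ^ (3 / 2 : ℝ) = (N : ℝ) ^ 3 := by
    rw [Nat.cast_pow, ← Real.rpow_natCast, ← Real.rpow_mul N.cast_nonneg, ← Real.rpow_natCast]
    norm_num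
  have hl := numDistinctTriangles_lower N
  have hu := numDistinctTriangles_upper N
  rw [hpow]
  push_cast
  constructor
  · linarith
  · linarith
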